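/- Let $\mathfrak{M}$ be a $W^*$-algebra and let $\mathcal{L}(\mathfrak{M})$ be the set (lattice) of its orthogonal projections. For $x\in\mathfrak{M}$ let $l(x)$ and $r(x)$ be the left and the right support of $x$, and write $s(a)=l(a)=r(a)$ for $a=a^*$. Let $\mathcal{G}(\mathfrak{M})$ be the set of partially invertible elements, i.e. of those $x\in\mathfrak{M}$ for which $|x|=(x^*x)^{1/2}$ is invertible in $p\mathfrak{M}p$, where $p=s(|x|)$. With source $S(x)=r(x)$, target $T(x)=l(x)$, the product of $\mathfrak{M}$ restricted to the pairs $(x,y)$ with $S(x)=T(y)$, the inclusion $\varepsilon:\mathcal{L}(\mathfrak{M})\to\mathcal{G}(\mathfrak{M})$ as identity section, and the inversion $\iota(x)=|x|^{-1}u^*$, where $x=u|x|$ is the polar decomposition and $|x|^{-1}$ is the inverse of $|x|$ in $p\mathfrak{M}p$, $\mathcal{G}(\mathfrak{M})$ is a groupoid with base $\mathcal{L}(\mathfrak{M})$. Projections $p,\tilde p$ are called equivalent, $\tilde p\sim p$, if $p=S(x)$ and $\tilde p=T(x)$ for some $x\in\mathcal{G}(\mathfrak{M})$. For $p\in\mathcal{L}(\mathfrak{M})$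 let $\Pi_p$ be the set of projections $q$ such that $\mathfrak{M}=q\mathfrak{M}\oplus(1-p)\mathfrak{M}$. For $q\in\Pi_p$ there are unique $\sigma_p(q)\in q\mathfrak{M}p$ and $\varphi_p(q)\in(1-p)\mathfrak{M}p$ with $p=\sigma_p(q)-\varphi_p(q)$, and $\sigma_p(q)\in\mathcal{G}(\mathfrak{M})$. For $\tilde p\sim p$ put $\Omega_{\tilde pp}=T^{-1}(\Pi_{\tilde p})\cap S^{-1}(\Pi_p)$ and define $$\psi_{\tilde pp}:\Omega_{\tilde pp}\to(1-\tilde p)\mathfrak{M}\tilde p\oplus\tilde p\mathfrak{M}p\oplus(1-p)\mathfrak{M}p,\qquad \psi_{\tilde pp}(x)=\bigl(\varphi_{\tilde p}(T(x)),\ \iota(\sigma_{\tilde p}(T(x)))\,x\,\sigma_p(S(x)),\ \varphi_p(S(x))\bigr).$$ Theorem. Each $\varphi_p:\Pi_p\to(1-p)\mathfrak{M}p$ is a bijection; the maps $\varphi_p$, $p\in\mathcal{L}(\mathfrak{M})$, form a complex analytic Banach manifold atlas on the set $\mathcal{L}(\mathfrak{M})$; and the maps $\psi_{\tilde pp}$,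 for $\tilde p\sim p$, form a complex analytic Banach manifold atlas on the set $\mathcal{G}(\mathfrak{M})$. (An atlas consists of injective maps from subsets that cover the set onto open subsets of complex Banach spaces, which may vary with the chart, such that the transition maps are analytic with open domains.) With these structures $\mathcal{G}(\mathfrak{M})$ is a complex analytic Banach-Lie groupoid with base $\mathcal{L}(\mathfrak{M})$: the source and target maps are analytic submersions (at each point the derivative is surjective with complemented kernel), the identity section is an analytic embedding (an analytic map that is a homeomorphism onto its image, and whose derivative at each point is injective with closed complemented range), the inversion is analytic, the set of composable pairs is a submanifold of $\mathcal{G}(\mathfrak{M})\times\mathcal{G}(\mathfrak{M})$, and the product is an analytic map from this submanifold to $\mathcal{G}(\mathfrak{M})$. -/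

import Mathlib

universe u v w

namespace BLG

/-! ### Complex analytic Banach manifolds given by an atlas on a set

The charts may take their values in different complex Banach spaces. -/

/-- A map from a subset `dom` of `X` to a complex Banach space `E`. -/
structure BanachChart (X : Type u) : Type (u + 1) where
  E : Type u
  [normed : NormedAddCommGroup E]
  [space : NormedSpace ℂ E]
  [complete : CompleteSpace E]
  dom : Set X
  toFun : dom → E

attribute [instance] BanachChart.normed BanachChart.space BanachChart.complete

/-- The image `c (dom c ∩ S)`. -/
def BanachChart.img {X : Type u} (c : BanachChart X) (S : Set X) : Set c.E :=
  c.toFun '' {x | (x : X) ∈ S}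

/-- A chart: an injective map onto an open subset of a Banach space. -/
def BanachChart.IsChart {X : Type u} (c : BanachChart X) : Prop :=
  Function.Injective c.toFun ∧ IsOpen (Set.range c.toFun)

/-- `g` is an analytic representative of `d ∘ f ∘ c⁻¹` on the set `c (dom c ∩ f⁻¹ (dom d))`. -/
def IsLocalRep {X Y : Type u} (c : BanachChart X) (d : BanachChart Y) (f : X → Y)
    (g : c.E → d.E) : Prop :=
  AnalyticOnNhd ℂ g (c.img (f ⁻¹' d.dom)) ∧
    ∀ (x : c.dom) (h : f x ∈ d.dom), g (c.toFun x) = d.toFun ⟨f x, h⟩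

/-- The set `c (dom c ∩ f⁻¹ (dom d))` is open and `d ∘ f ∘ c⁻¹` is analytic on it. -/
def AnalyticInCharts {X Y : Type u} (c : BanachChart X) (d : BanachChart Y) (f : X → Y) : Prop :=
  IsOpen (c.img (f ⁻¹' d.dom)) ∧ ∃ g : c.E → d.E, IsLocalRep c d f g

/-- Both transition maps have open domain and are analytic. -/
def Compatible {X : Type u} (c d : BanachChart X) : Prop :=
  AnalyticInCharts c d id ∧ AnalyticInCharts d c id

/-- The family `A` is a complex analytic atlas on the set `X`. -/
structure IsAnalyticAtlas {X : Type u} {I : Type v} (A : I → BanachChart X) : Prop where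
  isChart : ∀ i, (A i).IsChart
  cover : ∀ x : X, ∃ i, x ∈ (A i).dom
  compatible : ∀ i j, Compatible (A i) (A j)

/-- The manifold topology: it is generated by the sets `c⁻¹ (V)`, with `c` a chart of the atlas
and `V` open in the model space of `c`. -/
@[reducible]
def atlasTopology {X : Type u} {I : Type v} (A : I → BanachChart X) : TopologicalSpace X :=
  TopologicalSpace.generateFrom
    {U | ∃ (i : I) (V : Set (A i).E), IsOpen V ∧ U = Subtype.val '' ((A i).toFun ⁻¹' V)}

/-- Analytic maps between manifolds (the condition includes continuity: preimages of chart
domains are open). -/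
def IsAnalyticMap {X Y : Type u} {I : Type v} {J : Type w} (A : I → BanachChart X)
    (B : J → BanachChart Y) (f : X → Y) : Prop :=
  ∀ i j, AnalyticInCharts (A i) (B j) f

/-- Analytic submersion: at each point the derivative is surjective with complemented kernel. -/
def IsAnalyticSubmersion {X Y : Type u} {I : Type v} {J : Type w} (A : I → BanachChart X)
    (B : J → BanachChart Y) (f : X → Y) : Prop :=
  IsAnalyticMap A B f ∧
    ∀ i j (g : (A i).E → (B j).E), IsLocalRep (A i) (B j) f g →
      ∀ x : (A i).dom, f x ∈ (B j).dom →
        Function.Surjective (fderiv ℂ g ((A i).toFun x)) ∧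
          (LinearMap.ker (fderiv ℂ g ((A i).toFun x)).toLinearMap).ClosedComplemented

/-- Analytic immersion: at each point the derivative is injective with complemented range. -/
def IsAnalyticImmersion {X Y : Type u} {I : Type v} {J : Type w} (A : I → BanachChart X)
    (B : J → BanachChart Y) (f : X → Y) : Prop :=
  IsAnalyticMap A B f ∧
    ∀ i j (g : (A i).E → (B j).E), IsLocalRep (A i) (B j) f g →
      ∀ x : (A i).dom, f x ∈ (B j).dom →
        Function.Injective (fderiv ℂ g ((A i).toFun x)) ∧
          (LinearMap.range (fderiv ℂ g ((A i).toFun x)).toLinearMap).ClosedComplemented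

/-- Analytic embedding: an analytic immersion that is a homeomorphism onto its image. -/
def IsAnalyticEmbedding {X Y : Type u} {I : Type v} {J : Type w} (A : I → BanachChart X)
    (B : J → BanachChart Y) (f : X → Y) : Prop :=
  IsAnalyticImmersion A B f ∧ @Topology.IsEmbedding X Y (atlasTopology A) (atlasTopology B) f

/-- The product atlas. -/
noncomputable def prodAtlas {X Y : Type u} {I : Type v} {J : Type w} (A : I → BanachChart X)
    (B : J → BanachChart Y) (ij : I × J) : BanachChart (X × Y) where
  E := (A ij.1).E × (B ij.2).E
  dom := {z | z.1 ∈ (A ij.1).dom ∧ z.2 ∈ (B ij.2).dom}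
  toFun z := ((A ij.1).toFun ⟨z.1.1, z.2.1⟩, (B ij.2).toFun ⟨z.1.2, z.2.2⟩)

/-- A chart `c` of the manifold `X` (compatible with the atlas `A`) in which the subset `S` is a
slice: `c (dom c ∩ S) = c (dom c) ∩ F` for a closed complemented subspace `F`. -/
structure AdaptedChart {X : Type u} {I : Type v} (A : I → BanachChart X) (S : Set X) where
  chart : BanachChart X
  isChart : chart.IsChart
  compatible : ∀ i, Compatible chart (A i)
  F : Submodule ℂ chart.E
  complemented : F.ClosedComplemented
  slice : chart.img S = Set.range chart.toFun ∩ (F : Set chart.E)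

/-- `S` is a submanifold of the manifold with atlas `A`. -/
def IsSubmanifold {X : Type u} {I : Type v} (A : I → BanachChart X) (S : Set X) : Prop :=
  ∀ x ∈ S, ∃ a : AdaptedChart A S, x ∈ a.chart.dom

/-- The atlas of a submanifold: the restrictions to `S` of all adapted charts, with values in the
corresponding subspaces `F`. -/
noncomputable def subAtlas {X : Type u} {I : Type v} (A : I → BanachChart X) (S : Set X)
    (a : AdaptedChart A S) : BanachChart S where
  E := a.F
  complete := a.complemented.isClosed.completeSpace_coe
  dom := {s | (s : X) ∈ a.chart.dom}
  toFun s := ⟨a.chart.toFun ⟨s.1.1, s.2⟩, by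
    have h : a.chart.toFun ⟨s.1.1, s.2⟩ ∈ a.chart.img S := ⟨_, s.1.2, rfl⟩
    rw [a.slice] at h
    exact h.2⟩

/-! ### Groupoids -/

/-- A groupoid with set of arrows `G` and base set `B`; `mul g h` is defined when the source of `g`
is the target of `h`. -/
structure SetGroupoid (G B : Type u) where
  source : G → B
  target : G → B
  mul : ∀ g h : G, source g = target h → G
  unit : B → G
  inv : G → G
  source_mul : ∀ g h hgh, source (mul g h hgh) = source h
  target_mul : ∀ g h hgh, target (mul g h hgh) = target g
  mul_assoc : ∀ k g h (hkg : source k = target g) (hgh : source g = target h),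
    mul k (mul g h hgh) (hkg.trans (target_mul g h hgh).symm) =
      mul (mul k g hkg) h ((source_mul k g hkg).trans hgh)
  unit_injective : Function.Injective unit
  source_unit : ∀ b, source (unit b) = b
  target_unit : ∀ b, target (unit b) = b
  unit_mul : ∀ g, mul (unit (target g)) g (source_unit _) = g
  mul_unit : ∀ g, mul g (unit (source g)) (target_unit _).symm = g
  source_inv : ∀ g, source (inv g) = target g
  target_inv : ∀ g, target (inv g) = source g
  inv_mul : ∀ g, mul (inv g) g (source_inv g) = unit (source g)
  mul_inv : ∀ g, mul g (inv g) (target_inv g).symm = unit (target g)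

/-- The set of composable pairs. -/
def SetGroupoid.composable {G B : Type u} (𝒢 : SetGroupoid G B) : Set (G × G) :=
  {gh | 𝒢.source gh.1 = 𝒢.target gh.2}

/-- The product as a map on the set of composable pairs. -/
def SetGroupoid.mulMap {G B : Type u} (𝒢 : SetGroupoid G B) (gh : 𝒢.composable) : G :=
  𝒢.mul gh.1.1 gh.1.2 gh.2

/-- A complex analytic Banach-Lie groupoid: arrows and base are Banach manifolds, source and target
are submersions, the identity section is an embedding, inversion is analytic, the composable pairs
form a submanifold of the product manifold, and the product is analytic on this submanifold. -/
structure IsBanachLieGroupoid {G B : Type u} {I : Type v} {J : Type w} (𝒢 : SetGroupoid G B)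
    (arrows : I → BanachChart G) (base : J → BanachChart B) : Prop where
  arrows_atlas : IsAnalyticAtlas arrows
  base_atlas : IsAnalyticAtlas base
  source_submersion : IsAnalyticSubmersion arrows base 𝒢.source
  target_submersion : IsAnalyticSubmersion arrows base 𝒢.target
  unit_embedding : IsAnalyticEmbedding base arrows 𝒢.unit
  inv_analytic : IsAnalyticMap arrows arrows 𝒢.inv
  composable_submanifold : IsSubmanifold (prodAtlas arrows arrows) 𝒢.composable
  mul_analytic : IsAnalyticMap (subAtlas (prodAtlas arrows arrows) 𝒢.composable) arrows 𝒢.mulMap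

/-! ### Projections, supports and partially invertible elements -/

section Algebra

variable {M : Type u} [CStarAlgebra M]

/-- The orthogonal projections `p = p* = p²` of `M`. -/
@[ext]
structure Proj (M : Type u) [CStarAlgebra M] : Type u where
  val : M
  isStarProjection : IsStarProjection val

instance : CoeOut (Proj M) M := ⟨Proj.val⟩

/-- The usual order of projections. -/
instance : LE (Proj M) := ⟨fun p q => (p : M) * (q : M) = p⟩

theorem Proj.mul_self (p : Proj M) : (p : M) * p = p := p.isStarProjection.isIdempotentElem

theorem Proj.star_eq (p : Proj M) : star (p : M) = p := p.isStarProjection.isSelfAdjoint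

theorem Proj.le_antisymm {p q : Proj M} (h : p ≤ q) (h' : q ≤ p) : p = q := by
  apply Proj.ext
  have h1 : (p : M) * q = p := h
  have h2 : (q : M) * p = q := h'
  have h3 := congrArg star h2
  rw [star_mul, p.star_eq, q.star_eq, h1] at h3
  exact h3

/-- The complementary projection `1 - p`. -/
noncomputable def Proj.compl (p : Proj M) : Proj M := ⟨1 - (p : M), p.isStarProjection.one_sub⟩

/-- `p` is the smallest projection with `p x = x`. -/
def IsLeftSupport (x : M) (p : Proj M) : Prop :=
  (p : M) * x = x ∧ ∀ q : Proj M, (q : M) * x = x → p ≤ q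

/-- `p` is the smallest projection with `x p = x`. -/
def IsRightSupport (x : M) (p : Proj M) : Prop :=
  x * p = x ∧ ∀ q : Proj M, x * q = x → p ≤ q

theorem IsLeftSupport.unique {x : M} {p q : Proj M} (hp : IsLeftSupport x p)
    (hq : IsLeftSupport x q) : p = q :=
  Proj.le_antisymm (hp.2 q hq.1) (hq.2 p hp.1)

theorem IsRightSupport.unique {x : M} {p q : Proj M} (hp : IsRightSupport x p)
    (hq : IsRightSupport x q) : p = q :=
  Proj.le_antisymm (hp.2 q hq.1) (hq.2 p hp.1)

/-- The Banach subspace `a M b` of `M`. -/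
noncomputable def corner (a b : Proj M) : Submodule ℂ M :=
  LinearMap.range (LinearMap.mulLeftRight ℂ ((a : M), (b : M)))

theorem mem_corner {a b : Proj M} {z : M} :
    z ∈ corner a b ↔ (a : M) * z = z ∧ z * (b : M) = z := by
  constructor
  · rintro ⟨m, rfl⟩
    simp only [LinearMap.mulLeftRight_apply]
    constructor
    · simp only [← mul_assoc, a.mul_self]
    · rw [mul_assoc, b.mul_self]
  · rintro ⟨h1, h2⟩
    exact ⟨z, by simp only [LinearMap.mulLeftRight_apply, h1, h2]⟩

instance (a b : Proj M) : CompleteSpace (corner a b) := by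
  have h : IsClosed (corner a b : Set M) := by
    have h' : (corner a b : Set M) = {z | (a : M) * z = z} ∩ {z | z * (b : M) = z} := by
      ext z
      exact mem_corner
    rw [h']
    exact (isClosed_eq (by fun_prop) (by fun_prop)).inter (isClosed_eq (by fun_prop) (by fun_prop))
  exact h.completeSpace_coe

/-- The right ideal `q M`. -/
noncomputable def rightIdeal (q : Proj M) : Submodule ℂ M := LinearMap.range (LinearMap.mulLeft ℂ (q : M))

theorem mem_rightIdeal {q : Proj M} {z : M} : z ∈ rightIdeal q ↔ (q : M) * z = z := by
  constructor
  · rintro ⟨m, rfl⟩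
    simp only [LinearMap.mulLeft_apply, ← mul_assoc, q.mul_self]
  · intro h
    exact ⟨z, h⟩

/-- The absolute value `|x| = (x* x)^(1/2)`. -/
noncomputable def absVal (x : M) : M :=
  letI := CStarAlgebra.spectralOrder M
  haveI := CStarAlgebra.spectralOrderedRing M
  CFC.abs x

theorem absVal_mul_self (x : M) : absVal x * absVal x = star x * x := by
  let _ := CStarAlgebra.spectralOrder M
  have _ := CStarAlgebra.spectralOrderedRing M
  exact CFC.abs_mul_abs x

theorem star_absVal (x : M) : star (absVal x) = absVal x := by
  let _ := CStarAlgebra.spectralOrder M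
  have _ := CStarAlgebra.spectralOrderedRing M
  exact (CFC.abs_nonneg x).isSelfAdjoint

/-- `b` is the inverse of `a` in the algebra `p M p` with unit `p`. -/
def IsInverseIn (p : Proj M) (a b : M) : Prop :=
  a ∈ corner p p ∧ b ∈ corner p p ∧ a * b = p ∧ b * a = p

/-- `x` is partially invertible: `|x|` is invertible in `p M p`, with `p` the support of `|x|`. -/
def IsPartiallyInvertible (x : M) : Prop :=
  ∃ p : Proj M, IsRightSupport (absVal x) p ∧ ∃ b, IsInverseIn p (absVal x) b

/-- `w = |x|⁻¹ u*`, where `x = u |x|` is the polar decomposition (so that `u* u` is the support `p`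
of `|x|`) and `|x|⁻¹` is the inverse of `|x|` in `p M p`. -/
def IsPartialInverse (x w : M) : Prop :=
  ∃ (p : Proj M) (b u : M), IsRightSupport (absVal x) p ∧ IsInverseIn p (absVal x) b ∧
    x = u * absVal x ∧ star u * u = p ∧ w = b * star u

/-- Auxiliary: `w` is the Moore-Penrose inverse of `x`, with `x w = e` and `w x = f`. -/
structure IsMP (x w : M) (e f : Proj M) : Prop where
  xw : x * w = e
  wx : w * x = f
  ex : (e : M) * x = x
  fw : (f : M) * w = w
  we : w * (e : M) = w

theorem IsMP.xf {x w : M} {e f : Proj M} (h : IsMP x w e f) : x * (f : M) = x := by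
  rw [← h.wx, ← mul_assoc, h.xw, h.ex]

theorem IsMP.symm {x w : M} {e f : Proj M} (h : IsMP x w e f) : IsMP w x f e :=
  ⟨h.wx, h.xw, h.fw, h.ex, h.xf⟩

theorem IsMP.rightSupport {x w : M} {e f : Proj M} (h : IsMP x w e f) : IsRightSupport x f := by
  refine ⟨h.xf, fun q hq => ?_⟩
  change (f : M) * q = f
  rw [← h.wx, mul_assoc, hq]

theorem IsMP.leftSupport {x w : M} {e f : Proj M} (h : IsMP x w e f) : IsLeftSupport x e := by
  refine ⟨h.ex, fun q hq => ?_⟩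
  change (e : M) * q = e
  have h1 : (q : M) * e = e := by rw [← h.xw, ← mul_assoc, hq]
  have h2 := congrArg star h1
  rwa [star_mul, q.star_eq, e.star_eq] at h2

theorem IsMP.unique {x w w' : M} {e f e' f' : Proj M} (h : IsMP x w e f)
    (h' : IsMP x w' e' f') : w = w' := by
  obtain rfl := h.rightSupport.unique h'.rightSupport
  obtain rfl := h.leftSupport.unique h'.leftSupport
  calc w = f * w := h.fw.symm
    _ = w' * (x * w) := by rw [← h'.wx, mul_assoc]
    _ = w' := by rw [h.xw, h'.we]

theorem mul_proj_eq_of_star_mul {a : M} {p : Proj M} (h : star a * a * p = star a * a) :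
    a * p = a := by
  have h0 : star (a - a * p) * (a - a * p) = 0 := by
    rw [star_sub, star_mul, p.star_eq]
    have e1 : (star a - p * star a) * (a - a * p)
        = (star a * a - star a * a * p) - p * (star a * a - star a * a * p) := by
      noncomm_ring
    rw [e1, h]
    simp
  exact (sub_eq_zero.mp (CStarRing.star_mul_self_eq_zero_iff _ |>.mp h0)).symm

theorem IsMP.isPartiallyInvertible {x w : M} {e f : Proj M} (h : IsMP x w e f) :
    IsPartiallyInvertible x := by
  have hxs : star x * (e : M) = star x := by
    have := congrArg star h.ex
    rwa [star_mul, e.star_eq] at this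
  have hwf : star w * (f : M) = star w := by
    have := congrArg star h.fw
    rwa [star_mul, f.star_eq] at this
  have hsx : star x * star w = f := by rw [← star_mul, h.wx, f.star_eq]
  have hsa := star_absVal x
  have haa := absVal_mul_self x
  have haf : absVal x * (f : M) = absVal x := by
    apply mul_proj_eq_of_star_mul
    rw [hsa, haa, mul_assoc, h.xf]
  have hfa : (f : M) * absVal x = absVal x := by
    have := congrArg star haf
    rwa [star_mul, f.star_eq, hsa] at this
  set a := absVal x
  set z := w * star w with hz
  have haaz : a * a * z = f := by
    rw [haa, hz]
    calc star x * x * (w * star w) = star x * (x * w) * star w := by simp only [mul_assoc]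
      _ = f := by rw [h.xw, hxs, hsx]
  have hsz : star z = z := by rw [hz, star_mul, star_star]
  have hzaa : z * (a * a) = f := by
    have := congrArg star haaz
    rwa [star_mul, star_mul a a, hsa, hsz, f.star_eq] at this
  have hzf : z * f = z := by rw [hz, mul_assoc, hwf]
  have hza : z * a = a * z := by
    calc z * a = z * (a * f) := by rw [haf]
      _ = z * (a * a) * a * z := by rw [← haaz]; simp only [mul_assoc]
      _ = a * z := by rw [hzaa, hfa]
  have hba : a * z * a = f := by rw [← hza, mul_assoc, hzaa]
  refine ⟨f, ⟨haf, fun q hq => ?_⟩, a * z, mem_corner.mpr ⟨hfa, haf⟩, mem_corner.mpr ⟨?_, ?_⟩,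
    ?_, hba⟩
  · change (f : M) * q = f
    rw [← hba, mul_assoc, hq]
  · rw [← mul_assoc, hfa]
  · rw [mul_assoc, hzf]
  · rw [← mul_assoc, haaz]

theorem IsPartiallyInvertible.exists_inverse {x : M} (hx : IsPartiallyInvertible x) :
    ∃ w, IsPartialInverse x w := by
  obtain ⟨p, hp, b, hb⟩ := hx
  have hp' := hp
  have hb' := hb
  obtain ⟨ha, hbm, hab, hba⟩ := hb
  rw [mem_corner] at ha hbm
  have hsa := star_absVal x
  have haa := absVal_mul_self x
  have hxp : x * (p : M) = x := by
    apply mul_proj_eq_of_star_mul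
    rw [← haa, mul_assoc, ha.2]
  have hsb : star b * absVal x = p := by
    have := congrArg star hab
    rwa [star_mul, hsa, p.star_eq] at this
  refine ⟨_, p, b, x * b, hp', hb', ?_, ?_, rfl⟩
  · rw [mul_assoc, hba, hxp]
  · calc star (x * b) * (x * b) = star b * (star x * x) * b := by
          rw [star_mul]; simp only [mul_assoc]
      _ = (star b * absVal x) * (absVal x * b) := by rw [← haa]; simp only [mul_assoc]
      _ = p := by rw [hsb, hab, p.mul_self]

theorem IsPartialInverse.exists_isMP {x w : M} (h : IsPartialInverse x w) :
    ∃ e f : Proj M, IsMP x w e f := by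
  obtain ⟨p, b, u, hp, ⟨ha, hb, hab, hba⟩, hxu, huu, rfl⟩ := h
  rw [mem_corner] at ha hb
  have hup : u * (p : M) = u := by
    apply mul_proj_eq_of_star_mul
    rw [huu, p.mul_self]
  have hpu : (p : M) * star u = star u := by
    have := congrArg star hup
    rwa [star_mul, p.star_eq] at this
  have he : IsStarProjection (u * star u) := by
    refine ⟨?_, ?_⟩
    · change u * star u * (u * star u) = u * star u
      calc u * star u * (u * star u) = u * (star u * u) * star u := by simp only [mul_assoc]
        _ = u * star u := by rw [huu, hup]
    · change star (u * star u) = u * star u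
      rw [star_mul, star_star]
  refine ⟨⟨u * star u, he⟩, p, ?_, ?_, ?_, ?_, ?_⟩
  · calc x * (b * star u) = u * (absVal x * b) * star u := by
          conv_lhs => rw [hxu]
          simp only [mul_assoc]
      _ = u * star u := by rw [hab, hup]
  · calc b * star u * x = b * (star u * u) * absVal x := by
          conv_lhs => rw [hxu]
          simp only [mul_assoc]
      _ = p := by rw [huu, hb.2, hba]
  · calc u * star u * x = u * (star u * u) * absVal x := by
          conv_lhs => rw [hxu]
          simp only [mul_assoc]
      _ = x := by rw [huu, hup, ← hxu]
  · rw [← mul_assoc, hb.1]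
  · change b * star u * (u * star u) = b * star u
    calc b * star u * (u * star u) = b * (star u * u) * star u := by simp only [mul_assoc]
      _ = b * star u := by rw [huu, hb.2]

/-- The set of partially invertible elements of `M`. -/
@[ext]
structure PInv (M : Type u) [CStarAlgebra M] : Type u where
  val : M
  isPartiallyInvertible : IsPartiallyInvertible val

instance : CoeOut (PInv M) M := ⟨PInv.val⟩

/-- The inversion `x ↦ |x|⁻¹ u*` as an element of `M`. -/
noncomputable def invVal (x : PInv M) : M := x.isPartiallyInvertible.exists_inverse.choose

theorem invVal_spec (x : PInv M) : IsPartialInverse (x : M) (invVal x) :=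
  x.isPartiallyInvertible.exists_inverse.choose_spec

theorem exists_rightSupport (x : PInv M) : ∃ p : Proj M, IsRightSupport (x : M) p := by
  obtain ⟨e, f, h⟩ := (invVal_spec x).exists_isMP
  exact ⟨f, h.rightSupport⟩

theorem exists_leftSupport (x : PInv M) : ∃ p : Proj M, IsLeftSupport (x : M) p := by
  obtain ⟨e, f, h⟩ := (invVal_spec x).exists_isMP
  exact ⟨e, h.leftSupport⟩

/-- The source of `x` is its right support. -/
noncomputable def src (x : PInv M) : Proj M := (exists_rightSupport x).choose

/-- The target of `x` is its left support. -/
noncomputable def tgt (x : PInv M) : Proj M := (exists_leftSupport x).choose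

theorem isMP (x : PInv M) : IsMP (x : M) (invVal x) (tgt x) (src x) := by
  obtain ⟨e, f, h⟩ := (invVal_spec x).exists_isMP
  have h1 : f = src x := h.rightSupport.unique (exists_rightSupport x).choose_spec
  have h2 : e = tgt x := h.leftSupport.unique (exists_leftSupport x).choose_spec
  subst h1 h2
  exact h

theorem IsMP.src_eq {x : PInv M} {w : M} {e f : Proj M} (h : IsMP (x : M) w e f) : src x = f :=
  (isMP x).rightSupport.unique h.rightSupport

theorem IsMP.tgt_eq {x : PInv M} {w : M} {e f : Proj M} (h : IsMP (x : M) w e f) : tgt x = e :=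
  (isMP x).leftSupport.unique h.leftSupport

theorem IsMP.mul {x w y v : M} {e f g : Proj M} (h : IsMP x w e f) (h' : IsMP y v f g) :
    IsMP (x * y) (v * w) e g where
  xw := by
    calc x * y * (v * w) = x * (y * v) * w := by simp only [mul_assoc]
      _ = e := by rw [h'.xw, h.xf, h.xw]
  wx := by
    calc v * w * (x * y) = v * (w * x) * y := by simp only [mul_assoc]
      _ = g := by rw [h.wx, h'.we, h'.wx]
  ex := by rw [← mul_assoc, h.ex]
  fw := by rw [← mul_assoc, h'.fw]
  we := by rw [mul_assoc, h.we]

theorem Proj.isMP (p : Proj M) : IsMP (p : M) p p p :=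
  ⟨p.mul_self, p.mul_self, p.mul_self, p.mul_self, p.mul_self⟩

theorem isMP_mul (x y : PInv M) (h : src x = tgt y) :
    IsMP ((x : M) * (y : M)) (invVal y * invVal x) (tgt x) (src y) := by
  have h1 := isMP x
  have h2 := isMP y
  rw [h] at h1
  exact h1.mul h2

/-- The product of `M` on composable pairs. -/
noncomputable def pmul (x y : PInv M) (h : src x = tgt y) : PInv M :=
  ⟨(x : M) * (y : M), (isMP_mul x y h).isPartiallyInvertible⟩

/-- The inversion. -/
noncomputable def pinv (x : PInv M) : PInv M := ⟨invVal x, (isMP x).symm.isPartiallyInvertible⟩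

/-- The inclusion of the projections. -/
noncomputable def punit (p : Proj M) : PInv M := ⟨(p : M), p.isMP.isPartiallyInvertible⟩

/-- The groupoid of partially invertible elements of `M`, over the projections of `M`. -/
noncomputable def pinvGroupoid (M : Type u) [CStarAlgebra M] : SetGroupoid (PInv M) (Proj M) where
  source := src
  target := tgt
  mul := pmul
  unit := punit
  inv := pinv
  source_mul g h hgh := IsMP.src_eq (x := pmul g h hgh) (isMP_mul g h hgh)
  target_mul g h hgh := IsMP.tgt_eq (x := pmul g h hgh) (isMP_mul g h hgh)
  mul_assoc k g h _ _ := PInv.ext (mul_assoc (k : M) (g : M) (h : M)).symm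
  unit_injective _ _ h := Proj.ext (congrArg (fun x : PInv M => (x : M)) h)
  source_unit p := IsMP.src_eq (x := punit p) p.isMP
  target_unit p := IsMP.tgt_eq (x := punit p) p.isMP
  unit_mul g := PInv.ext (isMP g).ex
  mul_unit g := PInv.ext (isMP g).xf
  source_inv g := IsMP.src_eq (x := pinv g) (isMP g).symm
  target_inv g := IsMP.tgt_eq (x := pinv g) (isMP g).symm
  inv_mul g := PInv.ext (isMP g).wx
  mul_inv g := PInv.ext (isMP g).xw

/-! ### The charts -/

/-- The set `Π_p` of projections `q` with `M = q M ⊕ (1 - p) M`. -/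
def piSet (p : Proj M) : Set (Proj M) := {q | IsCompl (rightIdeal q) (rightIdeal p.compl)}

/-- The decomposition `p = x - y` with `x ∈ q M p` and `y ∈ (1 - p) M p`. -/
theorem exists_split (p : Proj M) (q : piSet p) :
    ∃! xy : corner q.1 p × corner p.compl p, (p : M) = (xy.1 : M) - (xy.2 : M) := by
  obtain ⟨q, hq⟩ := q
  have hd : ∀ z : M, (q : M) * z = z → (p.compl : M) * z = z → z = 0 := fun z h1 h2 =>
    Submodule.disjoint_def.mp hq.disjoint z (mem_rightIdeal.mpr h1) (mem_rightIdeal.mpr h2)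
  obtain ⟨x, hx, y, hy, hxy⟩ := Submodule.mem_sup.mp
    (hq.codisjoint.eq_top ▸ Submodule.mem_top : (p : M) ∈ rightIdeal q ⊔ rightIdeal p.compl)
  rw [mem_rightIdeal] at hx hy
  have hxy' : x * (p : M) + y * (p : M) = p := by rw [← add_mul, hxy, p.mul_self]
  have hx' : (q : M) * (x * p) = x * p := by rw [← mul_assoc, hx]
  have hy' : (p.compl : M) * (y * p) = y * p := by rw [← mul_assoc, hy]
  have hy'' : (p.compl : M) * (-(y * p)) = -(y * p) := by rw [mul_neg, hy']
  refine ⟨(⟨x * p, mem_corner.mpr ⟨hx', by rw [mul_assoc, p.mul_self]⟩⟩,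
    ⟨-(y * p), mem_corner.mpr ⟨hy'', by rw [neg_mul, mul_assoc, p.mul_self]⟩⟩), ?_, ?_⟩
  · change (p : M) = x * p - -(y * p)
    rw [sub_neg_eq_add, hxy']
  · rintro ⟨⟨a, ha⟩, ⟨b, hb⟩⟩ hab
    change (p : M) = a - b at hab
    rw [mem_corner] at ha hb
    have hdiff : a - x * p = b - -(y * p) := by
      rw [sub_neg_eq_add, sub_eq_iff_eq_add, add_assoc, add_comm (y * (p : M)), hxy', hab]
      abel
    have h0 : a - x * p = 0 := by
      apply hd
      · rw [mul_sub, ha.1, hx']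
      · rw [hdiff, mul_sub, hb.1, hy'']
    have h1 : b - -(y * p) = 0 := by rw [← hdiff, h0]
    exact Prod.ext (Subtype.ext (sub_eq_zero.mp h0)) (Subtype.ext (sub_eq_zero.mp h1))

/-- `σ_p (q) = x`, where `p = x - y` with `x ∈ q M p` and `y ∈ (1 - p) M p`. -/
noncomputable def sigma (p : Proj M) (q : piSet p) : corner q.1 p :=
  (exists_split p q).choose.1

/-- `φ_p (q) = y`, where `p = x - y` with `x ∈ q M p` and `y ∈ (1 - p) M p`. -/
noncomputable def phi (p : Proj M) (q : piSet p) : corner p.compl p :=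
  (exists_split p q).choose.2

theorem sigma_isMP (p : Proj M) (q : piSet p) :
    IsMP (sigma p q : M) ((p : M) * (q.1 : M)) q.1 p := by
  have hs : (p : M) = (sigma p q : M) - (phi p q : M) := (exists_split p q).choose_spec.1
  obtain ⟨hx1, hx2⟩ := mem_corner.mp (sigma p q).2
  obtain ⟨hy1, hy2⟩ := mem_corner.mp (phi p q).2
  set x : M := (sigma p q : M)
  set y : M := (phi p q : M)
  have hd : ∀ z : M, (q.1 : M) * z = z → (p.compl : M) * z = z → z = 0 := fun z h1 h2 =>
    Submodule.disjoint_def.mp q.2.disjoint z (mem_rightIdeal.mpr h1) (mem_rightIdeal.mpr h2)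
  have hx : x = p + y := by rw [hs]; abel
  have hpc : (p : M) * (p.compl : M) = 0 := by
    change (p : M) * (1 - p) = 0
    rw [mul_sub, mul_one, p.mul_self, sub_self]
  have hcp : (p.compl : M) * (p : M) = 0 := by
    change (1 - (p : M)) * p = 0
    rw [sub_mul, one_mul, p.mul_self, sub_self]
  have hpy : (p : M) * y = 0 := by rw [← hy1, ← mul_assoc, hpc, zero_mul]
  have hpx : (p : M) * x = p := by rw [hx, mul_add, p.mul_self, hpy, add_zero]
  have hxq : x * (q.1 : M) = q.1 := by
    symm
    rw [← sub_eq_zero]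
    apply hd
    · rw [mul_sub, ← mul_assoc, hx1, q.1.mul_self]
    · have e : (q.1 : M) - x * q.1 = (p.compl : M) * q.1 - (p.compl : M) * (y * q.1) := by
        rw [← mul_assoc, hy1, hx]
        change (q.1 : M) - (p + y) * q.1 = (1 - (p : M)) * q.1 - y * q.1
        noncomm_ring
      rw [e, mul_sub, ← mul_assoc, ← mul_assoc, p.compl.mul_self]
  refine ⟨?_, ?_, hx1, ?_, ?_⟩
  · rw [← mul_assoc, hx2, hxq]
  · rw [mul_assoc, hx1, hpx]
  · rw [← mul_assoc, p.mul_self]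
  · rw [mul_assoc, q.1.mul_self]

/-- `σ_p (q)` as a partially invertible element. -/
noncomputable def sigmaArrow (p : Proj M) (q : piSet p) : PInv M :=
  ⟨(sigma p q : M), (sigma_isMP p q).isPartiallyInvertible⟩

/-- The charts `φ_p : Π_p → (1 - p) M p` of the set of projections. -/
noncomputable def projAtlas (M : Type u) [CStarAlgebra M] (p : Proj M) : BanachChart (Proj M) where
  E := corner p.compl p
  dom := piSet p
  toFun := phi p

/-- Equivalence of projections: `p = S(x)` and `q = T(x)` for some partially invertible `x`. -/
def ProjEquiv (p q : Proj M) : Prop := ∃ x : PInv M, src x = p ∧ tgt x = q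

/-- `Ω_{p'p} = T⁻¹ (Π_{p'}) ∩ S⁻¹ (Π_p)`. -/
def omegaSet (p' p : Proj M) : Set (PInv M) := {x | tgt x ∈ piSet p' ∧ src x ∈ piSet p}

theorem psi_mid_mem {p' p : Proj M} (x : omegaSet p' p) :
    invVal (sigmaArrow p' ⟨tgt x.1, x.2.1⟩) * (x.1 : M) * (sigma p ⟨src x.1, x.2.2⟩ : M)
      ∈ corner p' p := by
  have h := isMP (sigmaArrow p' ⟨tgt x.1, x.2.1⟩)
  rw [IsMP.src_eq (x := sigmaArrow p' ⟨tgt x.1, x.2.1⟩) (sigma_isMP p' _)] at h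
  refine mem_corner.mpr ⟨?_, ?_⟩
  · rw [← mul_assoc, ← mul_assoc, h.fw]
  · rw [mul_assoc, (mem_corner.mp (sigma p ⟨src x.1, x.2.2⟩).2).2]

/-- `ψ_{p'p} (x) = (φ_{p'} (T(x)), ι(σ_{p'} (T(x))) x σ_p (S(x)), φ_p (S(x)))`. -/
noncomputable def psi (p' p : Proj M) (x : omegaSet p' p) :
    corner p'.compl p' × corner p' p × corner p.compl p :=
  (phi p' ⟨tgt x.1, x.2.1⟩,
    ⟨invVal (sigmaArrow p' ⟨tgt x.1, x.2.1⟩) * (x.1 : M) * (sigma p ⟨src x.1, x.2.2⟩ : M),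
      psi_mid_mem x⟩,
    phi p ⟨src x.1, x.2.2⟩)

/-- The charts `ψ_{p'p} : Ω_{p'p} → (1 - p') M p' ⊕ p' M p ⊕ (1 - p) M p` of the set of partially
invertible elements, indexed by the pairs of equivalent projections. -/
noncomputable def pinvAtlas (M : Type u) [CStarAlgebra M]
    (i : {pp : Proj M × Proj M // ProjEquiv pp.2 pp.1}) : BanachChart (PInv M) where
  E := corner i.1.1.compl i.1.1 × corner i.1.1 i.1.2 × corner i.1.2.compl i.1.2
  dom := omegaSet i.1.1 i.1.2
  toFun := psi i.1.1 i.1.2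

end Algebra

end BLG

/-!
The idea is that the right ideal `q M` of a projection `q ∈ Π_p` is the graph of an element `y =
φ_p(q)` of `(1 - p) M p`: the idempotent `σ_p(q) = p + y` is a partially invertible element with
left support `q` and right support `p`, whose inverse is `p q`. Conversely, for every `y` the
element `x = p + y` satisfies `x* x = p (1 + y* y)`, and `1 + y* y` is invertible, so `x` is
partially invertible; its left support `q` lies in `Π_p` and has `φ_p(q) = y`. Hence `φ_p` is a
bijection (`phi_bijective`).

If `q ∈ Π_p ∩ Π_{p'}`, then `g = σ_{p'}(q)⁻¹ σ_p(q) = p' (p + y)` is an affine function of `y`, and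
`p' + y' = (p + y) g⁻¹`; conversely, if `p' (p + y)` is invertible from `p` to `p'`, then `q ∈
Π_{p'}`. Near a point with inverse `w₀` the inverse of `z ∈ p' M p` is `(w₀ z + (1 - p))⁻¹ w₀`, so
invertibility is an open condition and inversion is analytic (`localInv`). This gives the analytic
transition maps between the `φ_p` (`phi_transition`).

An arrow `x` with `T(x) = q'` and `S(x) = q` is `σ_{p'}(q') z σ_p(q)⁻¹` for a unique invertible `z ∈
p' M p`, the middle coordinate of `ψ_{p'p}(x)`. The range of `ψ_{p'p}` is therefore the open set of
the `(y', z, y)` with `z` invertible, and `z` changes by `z ↦ g' z g⁻¹` with `g'` and `g` as above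
(`psi_mid_transition`). In suitable charts all structure maps are explicit: source and target are
`(y', z, y) ↦ y` and `(y', z, y) ↦ y'`, the unit is `y ↦ (y, p, y)`, inversion is `(y', z, y) ↦ (y,
z⁻¹, y')`, the composable pairs are given by the linear equation `y = y₁` on the pairs `((y', z, y),
(y₁, w, y₂))`, and the product is `(y', z w, y₂)`.

Analyticity is therefore checked for one convenient pair of charts around each point
(`isAnalyticMap_of_local`). The conditions on derivatives are obtained from the chain rule: a map
with analytic local sections is a submersion (`isAnalyticSubmersion_of_section`), and an analytic
map with an analytic left inverse is an embedding (`isAnalyticEmbedding_of_leftInverse`), here the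
identity section with the source map as left inverse.
-/

namespace BLG

open Filter Topology

/-! ### Analyticity in charts at a point -/

section Manifold

variable {X Y Z : Type u}

/-- The set `c (dom c ∩ f⁻¹ (dom d))` is a neighbourhood of `c x`, and the map `h`, analytic at
`c x`, represents `d ∘ f ∘ c⁻¹` near that point. For injective `c` this
includes `f x ∈ dom d`. -/
def IsLocalRepAt (c : BanachChart X) (d : BanachChart Y) (f : X → Y) (x : c.dom)
    (h : c.E → d.E) : Prop :=
  AnalyticAt ℂ h (c.toFun x) ∧ ∀ᶠ e in 𝓝 (c.toFun x),
    ∃ x' : c.dom, c.toFun x' = e ∧ ∃ hf : f x' ∈ d.dom, d.toFun ⟨f x', hf⟩ = h e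

/-- As the range of a chart is open, it is enough to compare `h` with `d ∘ f` at the points of the
chart domain. -/
theorem IsLocalRepAt.of_eventually {c : BanachChart X} {d : BanachChart Y} {f : X → Y} {x : c.dom}
    {h : c.E → d.E} (hc : c.IsChart) (hh : AnalyticAt ℂ h (c.toFun x))
    (H : ∀ᶠ e in 𝓝 (c.toFun x), ∀ x' : c.dom, c.toFun x' = e →
      ∃ hf : f x' ∈ d.dom, d.toFun ⟨f x', hf⟩ = h e) : IsLocalRepAt c d f x h := by
  refine ⟨hh, ?_⟩
  filter_upwards [H, hc.2.mem_nhds ⟨x, rfl⟩] with e he ⟨x', hx'⟩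
  exact ⟨x', hx', he x' hx'⟩

theorem IsLocalRepAt.apply_eq {c : BanachChart X} {d : BanachChart Y} {f : X → Y} {x : c.dom}
    {h : c.E → d.E} (H : IsLocalRepAt c d f x h) (hc : c.IsChart) :
    ∃ hf : f x ∈ d.dom, d.toFun ⟨f x, hf⟩ = h (c.toFun x) := by
  obtain ⟨x', hx', hf⟩ := H.2.self_of_nhds
  obtain rfl := hc.1 hx'
  exact hf

theorem IsLocalRepAt.comp {c : BanachChart X} {d : BanachChart Y} {e : BanachChart Z} {f : X → Y}
    {g : Y → Z} {x : c.dom} {y : d.dom} {h : c.E → d.E} {k : d.E → e.E} (hc : c.IsChart)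
    (hd : d.IsChart) (hxy : f x = y)
    (hg : IsLocalRepAt d e g y k) (hf : IsLocalRepAt c d f x h) :
    IsLocalRepAt c e (g ∘ f) x (k ∘ h) := by
  obtain ⟨hfx, hfx'⟩ := hf.apply_eq hc
  have hy : y = ⟨f x, hfx⟩ := Subtype.ext hxy.symm
  subst hy
  have hk := hg.1
  have hev := hg.2
  rw [hfx'] at hk hev
  refine ⟨hk.comp hf.1, ?_⟩
  filter_upwards [hf.2, hf.1.continuousAt.eventually hev] with v hv1 hv2
  obtain ⟨x', hx', hfx1, hfx2⟩ := hv1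
  obtain ⟨y', hy', hgy1, hgy2⟩ := hv2
  obtain rfl := hd.1 (hy'.trans hfx2.symm)
  exact ⟨x', hx', hgy1, hgy2⟩

theorem IsLocalRepAt.prodMap {X' Y' : Type u} {I I' J J' : Type*} {A : I → BanachChart X}
    {A' : I' → BanachChart X'} {B : J → BanachChart Y} {B' : J' → BanachChart Y'} {i : I} {i' : I'}
    {j : J} {j' : J'} {f : X → Y} {f' : X' → Y'} {x : (A i).dom} {x' : (A' i').dom}
    {h : (A i).E → (B j).E} {h' : (A' i').E → (B' j').E}
    (H : IsLocalRepAt (A i) (B j) f x h) (H' : IsLocalRepAt (A' i') (B' j') f' x' h') :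
    IsLocalRepAt (prodAtlas A A' (i, i')) (prodAtlas B B' (j, j')) (Prod.map f f')
      ⟨(x, x'), x.2, x'.2⟩ (Prod.map h h') := by
  constructor
  · have h1 : AnalyticAt ℂ h
        (((A i).toFun x, (A' i').toFun x') : (A i).E × (A' i').E).1 := H.1
    have h2 : AnalyticAt ℂ h'
        (((A i).toFun x, (A' i').toFun x') : (A i).E × (A' i').E).2 := H'.1
    exact (h1.fun_comp analyticAt_fst).prod (h2.fun_comp analyticAt_snd)
  · have := H.2.prod_mk H'.2
    rw [← nhds_prod_eq] at this
    refine Filter.Eventually.mono this ?_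
    rintro ⟨e, e'⟩ ⟨⟨y, rfl, hy1, hy2⟩, ⟨y', rfl, hy1', hy2'⟩⟩
    exact ⟨⟨(y, y'), y.2, y'.2⟩, rfl, ⟨hy1, hy1'⟩, Prod.ext hy2 hy2'⟩

/-- Analyticity in two charts can be checked pointwise: local representatives agree with
`d ∘ f ∘ c⁻¹`, so they glue. -/
theorem analyticInCharts_of_forall {c : BanachChart X} {d : BanachChart Y} {f : X → Y}
    (hc : c.IsChart) (H : ∀ x : c.dom, f x ∈ d.dom → ∃ h, IsLocalRepAt c d f x h) :
    AnalyticInCharts c d f := by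
  classical
  have hev : ∀ x : c.dom, f x ∈ d.dom → ∀ᶠ e in 𝓝 (c.toFun x), e ∈ c.img (f ⁻¹' d.dom) := by
    intro x hx
    obtain ⟨h, -, hh⟩ := H x hx
    filter_upwards [hh] with e ⟨x', hx', hf, _⟩
    exact ⟨x', hf, hx'⟩
  -- The set-theoretic map `d ∘ f ∘ c⁻¹`, extended by zero.
  let G : c.E → d.E := fun e =>
    if he : ∃ x' : c.dom, c.toFun x' = e ∧ f x' ∈ d.dom then
      d.toFun ⟨f he.choose, he.choose_spec.2⟩ else 0
  have hG : ∀ (x : c.dom) (h : f x ∈ d.dom), G (c.toFun x) = d.toFun ⟨f x, h⟩ := by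
    intro x hx
    have he : ∃ x' : c.dom, c.toFun x' = c.toFun x ∧ f x' ∈ d.dom := ⟨x, rfl, hx⟩
    have h1 : he.choose = x := hc.1 he.choose_spec.1
    simp only [G, dif_pos he, h1]
  refine ⟨?_, G, ?_, hG⟩
  · rw [isOpen_iff_mem_nhds]
    rintro _ ⟨x, hx, rfl⟩
    exact hev x hx
  · rintro _ ⟨x, hx, rfl⟩
    obtain ⟨h, hh, hh'⟩ := H x hx
    refine hh.congr ?_
    filter_upwards [hh'] with e ⟨x', hx', hf, hfe⟩
    rw [← hfe, ← hx', hG x' hf]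

theorem IsLocalRep.isLocalRepAt {c : BanachChart X} {d : BanachChart Y} {f : X → Y}
    {g : c.E → d.E} (hg : IsLocalRep c d f g) (ho : IsOpen (c.img (f ⁻¹' d.dom))) (x : c.dom)
    (hx : f x ∈ d.dom) : IsLocalRepAt c d f x g := by
  have hm : c.toFun x ∈ c.img (f ⁻¹' d.dom) := ⟨x, hx, rfl⟩
  refine ⟨hg.1 _ hm, ?_⟩
  filter_upwards [ho.mem_nhds hm] with e ⟨x', hx', he⟩
  exact ⟨x', he, hx', by rw [← he, hg.2 x' hx']⟩

theorem AnalyticInCharts.exists_isLocalRepAt {c : BanachChart X} {d : BanachChart Y} {f : X → Y}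
    (H : AnalyticInCharts c d f) (x : c.dom) (hx : f x ∈ d.dom) : ∃ h, IsLocalRepAt c d f x h :=
  let ⟨ho, g, hg⟩ := H
  ⟨g, hg.isLocalRepAt ho x hx⟩

/-- If `g ∘ f = id`, then the derivatives of representatives of `g` and `f` are inverse on one
side. -/
theorem IsLocalRepAt.fderiv_comp_eq_id {c : BanachChart X} {d : BanachChart Y} {f : X → Y}
    {g : Y → X} {x : c.dom} {y : d.dom} {h : c.E → d.E} {k : d.E → c.E} (hc : c.IsChart)
    (hd : d.IsChart) (hxy : f x = y) (hgf : ∀ x, g (f x) = x) (hg : IsLocalRepAt d c g y k)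
    (hf : IsLocalRepAt c d f x h) :
    (fderiv ℂ k (d.toFun y)).comp (fderiv ℂ h (c.toFun x)) = ContinuousLinearMap.id ℂ c.E := by
  have hcomp := hg.comp hc hd hxy hf
  obtain ⟨hfx, hfx'⟩ := hf.apply_eq hc
  have hy : d.toFun y = h (c.toFun x) := by
    rw [← hfx']
    exact congrArg _ (Subtype.ext hxy.symm)
  have heq : k ∘ h =ᶠ[𝓝 (c.toFun x)] id := by
    filter_upwards [hcomp.2] with e ⟨x', hx', h1, h2⟩
    rw [← h2, id, ← hx']
    exact congrArg _ (Subtype.ext (hgf x'))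
  have hk := hg.1
  rw [hy] at hk ⊢
  rw [← fderiv_comp _ hk.differentiableAt hf.1.differentiableAt, heq.fderiv_eq, fderiv_id]

/-! ### Analytic maps between manifolds -/

variable {I J : Type*} {A : I → BanachChart X} {B : J → BanachChart Y}

/-- Transport of a local representative of a map to another pair of charts. -/
theorem IsLocalRepAt.change_charts (hA : IsAnalyticAtlas A) (hB : IsAnalyticAtlas B) {f : X → Y}
    {i : I} {j : J} {x : (A i).dom} {k : (A i).E → (B j).E} (H : IsLocalRepAt (A i) (B j) f x k)
    (i' : I) (j' : J) (hx : (x : X) ∈ (A i').dom) (hf : f x ∈ (B j').dom) :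
    ∃ k', IsLocalRepAt (A i') (B j') f ⟨x, hx⟩ k' := by
  obtain ⟨h, hh⟩ := (hA.compatible i' i).1.exists_isLocalRepAt ⟨x, hx⟩ x.2
  obtain ⟨hfl, -⟩ := H.apply_eq (hA.isChart i)
  obtain ⟨m, hm⟩ := (hB.compatible j j').1.exists_isLocalRepAt ⟨f x, hfl⟩ hf
  have h1 := H.comp (hA.isChart i') (hA.isChart i) rfl hh
  have h2 := hm.comp (hA.isChart i') (hB.isChart j) rfl h1
  exact ⟨_, h2⟩

/-- A map between manifolds is analytic if around each point it is analytic in one pair of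
charts. -/
theorem isAnalyticMap_of_local (hA : IsAnalyticAtlas A) (hB : IsAnalyticAtlas B) {f : X → Y}
    (H : ∀ x, ∃ (i : I) (hx : x ∈ (A i).dom) (j : J) (k : _),
      IsLocalRepAt (A i) (B j) f ⟨x, hx⟩ k) : IsAnalyticMap A B f := fun i j =>
  analyticInCharts_of_forall (hA.isChart i) fun x hfx =>
    let ⟨_, _, _, _, hk⟩ := H x
    hk.change_charts hA hB i j x.2 hfx

/-- An analytic map with an analytic local section through every point is a submersion. The section
is a map `s` on all of `Y`, which need only be analytic at one point. -/
theorem isAnalyticSubmersion_of_section (hA : IsAnalyticAtlas A) (hB : IsAnalyticAtlas B)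
    {f : X → Y} (hf : IsAnalyticMap A B f)
    (H : ∀ x, ∃ (s : Y → X) (j : J) (hx : f x ∈ (B j).dom) (i : I) (k : _),
      (∀ y, f (s y) = y) ∧ s (f x) = x ∧ IsLocalRepAt (B j) (A i) s ⟨f x, hx⟩ k) :
    IsAnalyticSubmersion A B f := by
  refine ⟨hf, fun i j g hg x hfx => ?_⟩
  obtain ⟨s, j', hx', i', k, hs, hsx, hk⟩ := H x
  have hgx := hg.isLocalRepAt (hf i j).1 x hfx
  obtain ⟨k', hk'⟩ := hk.change_charts hB hA j i hfx (by rw [hsx]; exact x.2)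
  have hid := hgx.fderiv_comp_eq_id (hB.isChart j) (hA.isChart i) hsx hs hk'
  have hri : Function.RightInverse (fderiv ℂ k' ((B j).toFun ⟨f x, hfx⟩))
      (fderiv ℂ g ((A i).toFun x)) := fun v => DFunLike.congr_fun hid v
  exact ⟨hri.surjective,
    ContinuousLinearMap.closedComplemented_ker_of_rightInverse _ _ hri⟩

theorem isAnalyticImmersion_of_leftInverse (hA : IsAnalyticAtlas A) (hB : IsAnalyticAtlas B)
    {f : X → Y} {g : Y → X} (hf : IsAnalyticMap A B f) (hg : IsAnalyticMap B A g)
    (hgf : Function.LeftInverse g f) : IsAnalyticImmersion A B f := by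
  refine ⟨hf, fun i j h hh x hfx => ?_⟩
  have hhx := hh.isLocalRepAt (hf i j).1 x hfx
  obtain ⟨k, hk⟩ := (hg j i).exists_isLocalRepAt ⟨f x, hfx⟩ (by
    change g (f x) ∈ _
    rw [hgf x]
    exact x.2)
  have hid := hk.fderiv_comp_eq_id (hA.isChart i) (hB.isChart j) rfl hgf hhx
  have hli : Function.LeftInverse (fderiv ℂ k ((B j).toFun ⟨f x, hfx⟩))
      (fderiv ℂ h ((A i).toFun x)) := fun v => DFunLike.congr_fun hid v
  exact ⟨hli.injective, ContinuousLinearMap.closedComplemented_range_of_leftInverse _ _ hli⟩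

/-- Analytic maps are continuous for the manifold topologies. -/
theorem IsAnalyticMap.continuous (hA : IsAnalyticAtlas A) {f : X → Y}
    (hf : IsAnalyticMap A B f) : @Continuous X Y (atlasTopology A) (atlasTopology B) f := by
  let := atlasTopology A
  refine continuous_generateFrom_iff.mpr ?_
  rintro _ ⟨j, V, hV, rfl⟩
  rw [isOpen_iff_forall_mem_open]
  rintro x ⟨y, hy, hyx⟩
  obtain ⟨i, hi⟩ := hA.cover x
  have hfx : f x ∈ (B j).dom := hyx ▸ y.2
  obtain rfl : y = ⟨f x, hfx⟩ := Subtype.ext hyx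
  obtain ⟨h, hh⟩ := (hf i j).exists_isLocalRepAt ⟨x, hi⟩ hfx
  obtain ⟨_, heq⟩ := hh.apply_eq (hA.isChart i)
  have hVx : ∀ᶠ e in 𝓝 ((A i).toFun ⟨x, hi⟩), h e ∈ V := by
    refine hh.1.continuousAt.eventually (hV.mem_nhds ?_)
    rw [← heq]
    exact hy
  obtain ⟨W, hWsub, hW, hxW⟩ := mem_nhds_iff.mp (hh.2.and hVx)
  refine ⟨Subtype.val '' ((A i).toFun ⁻¹' W), ?_, TopologicalSpace.isOpen_generateFrom_of_mem
    ⟨i, W, hW, rfl⟩, ⟨⟨x, hi⟩, hxW, rfl⟩⟩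
  rintro _ ⟨x', hx', rfl⟩
  obtain ⟨⟨x'', hx'', hf1, hf2⟩, hV'⟩ := hWsub hx'
  obtain rfl := (hA.isChart i).1 hx''
  refine ⟨⟨f x'', hf1⟩, ?_, rfl⟩
  change (B j).toFun _ ∈ V
  rw [hf2]
  exact hV'

theorem isAnalyticEmbedding_of_leftInverse (hA : IsAnalyticAtlas A) (hB : IsAnalyticAtlas B)
    {f : X → Y} {g : Y → X} (hf : IsAnalyticMap A B f) (hg : IsAnalyticMap B A g)
    (hgf : Function.LeftInverse g f) : IsAnalyticEmbedding A B f := by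
  refine ⟨isAnalyticImmersion_of_leftInverse hA hB hf hg hgf, ?_⟩
  let := atlasTopology A
  let := atlasTopology B
  exact hgf.isEmbedding (hg.continuous hB) (hf.continuous hA)

/-! ### Products and submanifolds -/

theorem IsAnalyticAtlas.prodAtlas (hA : IsAnalyticAtlas A) (hB : IsAnalyticAtlas B) :
    IsAnalyticAtlas (prodAtlas A B) := by
  have hchart : ∀ ij, (BLG.prodAtlas A B ij).IsChart := by
    rintro ⟨i, j⟩
    constructor
    · rintro ⟨⟨x, y⟩, hx, hy⟩ ⟨⟨x', y'⟩, hx', hy'⟩ h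
      have h1 := (hA.isChart i).1 (congrArg Prod.fst h)
      have h2 := (hB.isChart j).1 (congrArg Prod.snd h)
      simp only [Subtype.mk.injEq] at h1 h2
      subst h1 h2
      rfl
    · have : Set.range (BLG.prodAtlas A B (i, j)).toFun
          = Set.range (A i).toFun ×ˢ Set.range (B j).toFun := by
        ext ⟨e, e'⟩
        constructor
        · rintro ⟨⟨⟨x, y⟩, hx, hy⟩, h⟩
          exact ⟨⟨⟨x, hx⟩, congrArg Prod.fst h⟩, ⟨⟨y, hy⟩, congrArg Prod.snd h⟩⟩
        · rintro ⟨⟨x, hx⟩, ⟨y, hy⟩⟩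
          exact ⟨⟨(x, y), x.2, y.2⟩, Prod.ext hx hy⟩
      rw [this]
      exact (hA.isChart i).2.prod (hB.isChart j).2
  have hcomp : ∀ ij ij', AnalyticInCharts (BLG.prodAtlas A B ij) (BLG.prodAtlas A B ij') id := by
    rintro ⟨i, j⟩ ⟨i', j'⟩
    refine analyticInCharts_of_forall (hchart _) ?_
    rintro ⟨⟨x, y⟩, hx, hy⟩ ⟨hx', hy'⟩
    obtain ⟨h, hh⟩ := (hA.compatible i i').1.exists_isLocalRepAt ⟨x, hx⟩ hx'
    obtain ⟨k, hk⟩ := (hB.compatible j j').1.exists_isLocalRepAt ⟨y, hy⟩ hy'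
    exact ⟨_, hh.prodMap hk⟩
  refine ⟨hchart, fun z => ?_, fun i j => ⟨hcomp i j, hcomp j i⟩⟩
  obtain ⟨i, hi⟩ := hA.cover z.1
  obtain ⟨j, hj⟩ := hB.cover z.2
  exact ⟨(i, j), hi, hj⟩

theorem isChart_subAtlas (S : Set X) (a : AdaptedChart A S) : (subAtlas A S a).IsChart := by
  constructor
  · intro s t h
    have h1 := a.isChart.1 (congrArg (fun v : a.F => (v : a.chart.E)) h)
    exact Subtype.ext (Subtype.ext (congrArg (fun x : a.chart.dom => (x : X)) h1))
  · have : Set.range (subAtlas A S a).toFun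
        = (fun v : a.F => (v : a.chart.E)) ⁻¹' Set.range a.chart.toFun := by
      refine Set.ext fun (v : a.F) => ⟨?_, fun hv => ?_⟩
      · rintro ⟨s, rfl⟩
        exact ⟨_, rfl⟩
      · have hv' : (v : a.chart.E) ∈ a.chart.img S := by
          rw [a.slice]
          exact ⟨hv, v.2⟩
        obtain ⟨x, hx, hxv⟩ := hv'
        exact ⟨⟨⟨x, hx⟩, x.2⟩, Subtype.ext hxv⟩
    rw [this]
    exact a.isChart.2.preimage continuous_subtype_val

/-- The inclusion of a submanifold is analytic. -/
theorem exists_isLocalRepAt_val {S : Set X} (a : AdaptedChart A S) (i : I)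
    (s : (subAtlas A S a).dom) (hs : (s.1 : X) ∈ (A i).dom) :
    ∃ h, IsLocalRepAt (subAtlas A S a) (A i) Subtype.val s h := by
  obtain ⟨h, hh⟩ := (a.compatible i).1.exists_isLocalRepAt ⟨s.1, s.2⟩ hs
  have hincl : IsLocalRepAt (subAtlas A S a) a.chart Subtype.val s a.F.subtypeL :=
    IsLocalRepAt.of_eventually (isChart_subAtlas S a) (a.F.subtypeL.analyticAt _)
      (Eventually.of_forall fun e x' hx' => ⟨x'.2, congrArg Subtype.val hx'⟩)
  have h1 := hh.comp (isChart_subAtlas S a) a.isChart rfl hincl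
  exact ⟨_, h1⟩

end Manifold

/-! ### Inversion in corners -/

section Algebra

variable {M : Type u} [CStarAlgebra M]

/-- The projection `m ↦ a m b` of `M` onto the corner `a M b`. -/
noncomputable def cornerProj (a b : Proj M) : M →L[ℂ] corner a b :=
  (ContinuousLinearMap.mulLeftRight ℂ M (a : M) (b : M)).codRestrict (corner a b) fun m =>
    mem_corner.mpr ⟨by simp [← mul_assoc, a.mul_self], by simp [mul_assoc, b.mul_self]⟩

theorem cornerProj_eq {a b : Proj M} {m : M} {z : corner a b} (h : m = z) :
    cornerProj a b m = z := by
  subst h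
  obtain ⟨h1, h2⟩ := mem_corner.mp z.2
  apply Subtype.ext
  change (a : M) * z * b = z
  rw [h1, h2]

/-- If `w₀` is the inverse of `z₀ ∈ e M p`, then this is the inverse of `z ∈ e M p` for `z` close to
`z₀`: the element `w₀ z + (1 - p)` is close to `1`. -/
noncomputable def localInv (p : Proj M) (w₀ z : M) : M :=
  Ring.inverse (w₀ * z + (1 - (p : M))) * w₀

theorem IsMP.analyticAt_localInv {z₀ w₀ : M} {e p : Proj M} (h : IsMP z₀ w₀ e p) :
    AnalyticAt ℂ (localInv p w₀) z₀ := by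
  have h1 : AnalyticAt ℂ (fun z : M => w₀ * z + (1 - (p : M))) z₀ := by fun_prop
  have h2 : AnalyticAt ℂ Ring.inverse (w₀ * z₀ + (1 - (p : M))) := by
    rw [h.wx, add_sub_cancel]
    exact analyticAt_inverse (𝕜 := ℂ) (1 : Mˣ)
  exact (AnalyticAt.fun_comp (g := Ring.inverse) (f := fun z => w₀ * z + (1 - (p : M)))
    h2 h1).mul analyticAt_const

theorem IsMP.eventually_isMP_localInv {z₀ w₀ : M} {e p : Proj M} (h : IsMP z₀ w₀ e p) :
    ∀ᶠ z in 𝓝 z₀, (e : M) * z = z → z * (p : M) = z → IsMP z (localInv p w₀ z) e p := by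
  have hcont : ContinuousAt (fun z : M => w₀ * z + (1 - (p : M))) z₀ := by fun_prop
  have hone : IsUnit (w₀ * z₀ + (1 - (p : M))) := by
    rw [h.wx, add_sub_cancel]
    exact isUnit_one
  filter_upwards [hcont.eventually (Units.isOpen.mem_nhds hone)] with z hz he hp
  -- The unit `U = w₀ z + (1 - p)` commutes with `p`, and `p U = w₀ z`.
  obtain ⟨U, hU⟩ := hz
  have hloc : localInv p w₀ z = (↑U⁻¹ : M) * w₀ := by
    rw [localInv, ← hU, Ring.inverse_unit]
  have hpU : (p : M) * U = w₀ * z := by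
    rw [hU, mul_add, mul_sub, mul_one, p.mul_self, sub_self, add_zero, ← mul_assoc, h.fw]
  have hUp : (U : M) * p = w₀ * z := by
    rw [hU, add_mul, sub_mul, one_mul, p.mul_self, sub_self, add_zero, mul_assoc, hp]
  have hpUi : (p : M) * (↑U⁻¹ : M) = (↑U⁻¹ : M) * p := by
    rw [← Units.mul_left_inj U, mul_assoc, Units.inv_mul, mul_one, mul_assoc, hpU, ← hUp,
      ← mul_assoc, Units.inv_mul, one_mul]
  rw [hloc]
  refine ⟨?_, ?_, he, ?_, ?_⟩
  · calc z * ((↑U⁻¹ : M) * w₀) = (z₀ * w₀ * z) * ((↑U⁻¹ : M) * w₀) := by rw [h.xw, he]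
      _ = z₀ * (w₀ * z) * (↑U⁻¹ : M) * w₀ := by simp only [mul_assoc]
      _ = z₀ * ((p : M) * (U * (↑U⁻¹ : M))) * w₀ := by rw [← hpU]; simp only [mul_assoc]
      _ = e := by rw [Units.mul_inv, mul_one, h.xf, h.xw]
  · rw [mul_assoc, ← hUp, ← mul_assoc, Units.inv_mul, one_mul]
  · rw [← mul_assoc, hpUi, mul_assoc, h.fw]
  · rw [mul_assoc, h.we]

/-! ### The charts of the set of projections -/

theorem Proj.mul_compl (p : Proj M) : (p : M) * (p.compl : M) = 0 := by
  change (p : M) * (1 - p) = 0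
  rw [mul_sub, mul_one, p.mul_self, sub_self]

theorem Proj.mul_corner_compl {p q : Proj M} (y : corner p.compl q) : (p : M) * y = 0 := by
  rw [← (mem_corner.mp y.2).1, ← mul_assoc, p.mul_compl, zero_mul]

theorem Proj.mul_add_corner_compl {p : Proj M} (y : corner p.compl p) :
    (p : M) * ((p : M) + y) = p := by
  rw [mul_add, p.mul_self, p.mul_corner_compl, add_zero]

theorem Proj.add_corner_compl_mul {p : Proj M} (y : corner p.compl p) :
    ((p : M) + y) * (p : M) = p + y := by
  rw [add_mul, p.mul_self, (mem_corner.mp y.2).2]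

theorem sigma_eq (p : Proj M) (q : piSet p) : (sigma p q : M) = p + phi p q := by
  have hs : (p : M) = (sigma p q : M) - (phi p q : M) := (exists_split p q).choose_spec.1
  exact (sub_eq_iff_eq_add.mp hs.symm)

theorem phi_isMP (p : Proj M) (q : piSet p) :
    IsMP ((p : M) + phi p q) ((p : M) * (q.1 : M)) q.1 p := by
  rw [← sigma_eq]
  exact sigma_isMP p q

/-- The value of the chart `φ_p` is recognised by `q` being the left support of `p + y`. -/
theorem IsMP.phi_eq {p q : Proj M} {y : corner p.compl p} {w : M} (h : IsMP ((p : M) + y) w q p) :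
    ∃ hq : q ∈ piSet p, phi p ⟨q, hq⟩ = y := by
  have hq : q ∈ piSet p := by
    refine ⟨?_, ?_⟩
    · rw [Submodule.disjoint_def]
      intro z hz1 hz2
      rw [mem_rightIdeal] at hz1 hz2
      have hpz : (p : M) * z = 0 := by rw [← hz2, ← mul_assoc, p.mul_compl, zero_mul]
      have hwz : w * z = 0 := by
        rw [← h.fw, ← p.mul_add_corner_compl y, mul_assoc, mul_assoc, ← mul_assoc _ w, h.xw, hz1,
          hpz]
      rw [← hz1, ← h.xw, mul_assoc, hwz, mul_zero]
    · rw [codisjoint_iff, Submodule.eq_top_iff']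
      intro m
      refine Submodule.mem_sup.mpr ⟨((p : M) + y) * m, ?_, m - ((p : M) + y) * m, ?_,
        add_sub_cancel _ _⟩
      · rw [mem_rightIdeal, ← mul_assoc, h.ex]
      · rw [mem_rightIdeal]
        change (1 - (p : M)) * _ = _
        rw [sub_mul, one_mul, mul_sub, ← mul_assoc, p.mul_add_corner_compl, sub_self, sub_zero]
  refine ⟨hq, ?_⟩
  -- `p = (p + y) - y` is a decomposition of the required kind, and it is unique.
  have hx : (p : M) + y ∈ corner q p := mem_corner.mpr ⟨h.ex, p.add_corner_compl_mul y⟩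
  have huniq := (exists_split p ⟨q, hq⟩).unique (exists_split p ⟨q, hq⟩).choose_spec.1
    (y₂ := (⟨(p : M) + y, hx⟩, y)) (by simp)
  exact congrArg Prod.snd huniq

theorem phi_injective (p : Proj M) : Function.Injective (phi p) := by
  intro q q' h
  have h1 := phi_isMP p q
  rw [h] at h1
  exact Subtype.ext (h1.leftSupport.unique (phi_isMP p q').leftSupport)

/-- The spectrum of `y* y` does not contain `-1`. -/
theorem isUnit_one_add_star_mul_self (y : M) : IsUnit (1 + star y * y) := by
  have h : (-1 : ℝ) ∉ spectrum ℝ (star y * y) := fun h => by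
    have := spectrum_star_mul_self_nonneg _ h
    linarith
  rw [spectrum.notMem_iff, map_neg, map_one, ← neg_add', IsUnit.neg_iff] at h
  exact h

/-- The idempotent `x = p + y` satisfies `x* x = p (1 + y* y)`, which is invertible in `p M p`, so
`x` is partially invertible with right support `p`. -/
theorem exists_isMP_add (p : Proj M) (y : corner p.compl p) :
    ∃ (q : Proj M) (w : M), IsMP ((p : M) + y) w q p := by
  -- The inverse is `w = U⁻¹ x*` with `U = 1 + y* y`, which commutes with `p`; the left support is
  -- `q = x w`.
  obtain ⟨U, hU⟩ := isUnit_one_add_star_mul_self (y : M)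
  have hyp := (mem_corner.mp y.2).2
  have hpy := p.mul_corner_compl y
  have hpy' : (p : M) * star (y : M) = star (y : M) := by
    have := congrArg star hyp
    rwa [star_mul, p.star_eq] at this
  have hyp' : star (y : M) * (p : M) = 0 := by
    have := congrArg star hpy
    rwa [star_mul, p.star_eq, star_zero] at this
  have hpU : (p : M) * U = p + star (y : M) * y := by
    rw [hU, mul_add, mul_one, ← mul_assoc, hpy']
  have hUp : (U : M) * p = p + star (y : M) * y := by
    rw [hU, add_mul, one_mul, mul_assoc, hyp]
  have hpUi : (p : M) * (↑U⁻¹ : M) = (↑U⁻¹ : M) * p := by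
    rw [← Units.mul_left_inj U, mul_assoc, Units.inv_mul, mul_one, mul_assoc, hpU, ← hUp,
      ← mul_assoc, Units.inv_mul, one_mul]
  have hUs : star (U : M) = U := by
    rw [hU, star_add, star_one, star_mul, star_star]
  have hUis : star (↑U⁻¹ : M) = (↑U⁻¹ : M) := by
    rw [← Units.mul_left_inj U]
    have := congrArg star (Units.mul_inv U)
    rwa [star_mul, hUs, star_one, ← Units.inv_mul U] at this
  set x : M := (p : M) + y with hx
  have hxp : x * p = x := p.add_corner_compl_mul y
  have hpx : (p : M) * star x = star x := by
    have := congrArg star hxp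
    rwa [star_mul, p.star_eq] at this
  have hxx : star x * x = p * U := by
    rw [hpU, hx, star_add, p.star_eq, add_mul, mul_add, mul_add, p.mul_self, hpy, hyp', add_zero,
      zero_add]
  have hwx : (↑U⁻¹ : M) * star x * x = p := by
    rw [mul_assoc, hxx, ← mul_assoc, ← hpUi, mul_assoc, Units.inv_mul, mul_one]
  have hq : IsStarProjection (x * ((↑U⁻¹ : M) * star x)) := by
    constructor
    · change x * ((↑U⁻¹ : M) * star x) * (x * ((↑U⁻¹ : M) * star x)) = x * ((↑U⁻¹ : M) * star x)
      rw [mul_assoc x, ← mul_assoc _ x, hwx, ← mul_assoc x, hxp]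
    · change star _ = _
      rw [star_mul, star_mul, star_star, hUis, mul_assoc]
  refine ⟨⟨_, hq⟩, (↑U⁻¹ : M) * star x, rfl, hwx, ?_, ?_, ?_⟩
  · change x * ((↑U⁻¹ : M) * star x) * x = x
    rw [mul_assoc x, hwx, hxp]
  · rw [← mul_assoc, hpUi, mul_assoc, hpx]
  · change (↑U⁻¹ : M) * star x * (x * ((↑U⁻¹ : M) * star x)) = _
    rw [← mul_assoc _ x, hwx, ← mul_assoc, hpUi, mul_assoc, hpx]

theorem phi_bijective (p : Proj M) : Function.Bijective (phi p) := by
  refine ⟨phi_injective p, fun y => ?_⟩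
  obtain ⟨q, w, h⟩ := exists_isMP_add p y
  obtain ⟨hq, hy⟩ := h.phi_eq
  exact ⟨⟨q, hq⟩, hy⟩

theorem isChart_projAtlas (p : Proj M) : (projAtlas M p).IsChart :=
  ⟨phi_injective p, by
    have h : Set.range (projAtlas M p).toFun = Set.univ := (phi_bijective p).2.range_eq
    rw [h]
    exact isOpen_univ⟩

theorem Proj.mem_piSet_self (p : Proj M) : p ∈ piSet p :=
  (IsMP.phi_eq (y := (0 : corner p.compl p)) (w := (p : M)) (q := p) (by simpa using p.isMP)).1

/-- The change of section: `σ_{p'}(q)⁻¹ σ_p(q) = p' (p + φ_p(q))`. -/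
theorem transition_isMP {p p' q : Proj M} (hq : q ∈ piSet p) (hq' : q ∈ piSet p') :
    IsMP ((p' : M) * ((p : M) + phi p ⟨q, hq⟩))
      ((p : M) * ((p' : M) + phi p' ⟨q, hq'⟩)) p' p := by
  have h := phi_isMP p ⟨q, hq⟩
  have h' := phi_isMP p' ⟨q, hq'⟩
  have hm := h'.symm.mul h
  have e1 : (p' : M) * (q : M) * ((p : M) + phi p ⟨q, hq⟩) = p' * (p + phi p ⟨q, hq⟩) := by
    rw [mul_assoc, h.ex]
  have e2 : (p : M) * (q : M) * ((p' : M) + phi p' ⟨q, hq'⟩) = p * (p' + phi p' ⟨q, hq'⟩) := by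
    rw [mul_assoc, h'.ex]
  rwa [e1, e2] at hm

/-- The transition map of the charts `φ_p`: with `g = p' (p + y)` invertible from `p` to `p'`, the
section `σ_{p'}(q)` is `(p + y) g⁻¹`. -/
theorem phi_transition {p p' q : Proj M} (hq : q ∈ piSet p) {v : M}
    (hv : IsMP ((p' : M) * ((p : M) + phi p ⟨q, hq⟩)) v p' p) :
    ∃ hq' : q ∈ piSet p', (p' : M) + phi p' ⟨q, hq'⟩ = ((p : M) + phi p ⟨q, hq⟩) * v := by
  have hm := (phi_isMP p ⟨q, hq⟩).mul hv.symm
  set x : M := (p : M) + phi p ⟨q, hq⟩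
  have hy : x * v - p' ∈ corner p'.compl p' := by
    refine mem_corner.mpr ⟨?_, ?_⟩
    · change (1 - (p' : M)) * _ = _
      rw [sub_mul, one_mul, mul_sub, ← mul_assoc, hv.xw, p'.mul_self, sub_self, sub_zero]
    · rw [sub_mul, mul_assoc, hv.we, p'.mul_self]
  have hm' : IsMP ((p' : M) + ((⟨x * v - p', hy⟩ : corner p'.compl p') : M))
      ((p' : M) * x * ((p : M) * (q : M))) q p' := by
    rw [add_sub_cancel]
    exact hm
  obtain ⟨hq', h⟩ := hm'.phi_eq
  refine ⟨hq', ?_⟩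
  rw [h, add_sub_cancel]

/-- The transition function `g(y) = p' (p + y)`. -/
noncomputable def transitionFun (p' p : Proj M) (y : corner p.compl p) : M :=
  (p' : M) * ((p : M) + y)

theorem analyticAt_transitionFun (p' p : Proj M) (y : corner p.compl p) :
    AnalyticAt ℂ (transitionFun p' p) y := by
  have h : AnalyticAt ℂ (fun y : corner p.compl p => (y : M)) y :=
    (corner p.compl p).subtypeL.analyticAt y
  exact analyticAt_const.mul (analyticAt_const.add h)

theorem eventually_isMP_transitionFun {p p' : Proj M} {y₀ : corner p.compl p} {w₀ : M}
    (h : IsMP (transitionFun p' p y₀) w₀ p' p) : ∀ᶠ y in 𝓝 y₀,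
      IsMP (transitionFun p' p y) (localInv p w₀ (transitionFun p' p y)) p' p := by
  filter_upwards [(analyticAt_transitionFun p' p y₀).continuousAt.eventually
    h.eventually_isMP_localInv] with y hy
  refine hy ?_ ?_
  · rw [transitionFun, ← mul_assoc, p'.mul_self]
  · rw [transitionFun, mul_assoc, p.add_corner_compl_mul]

/-- The transition map between `φ_p` and `φ_{p'}`, represented near a point of the overlap by
`y ↦ (p + y) g(y)⁻¹ - p'`. -/
theorem exists_analyticAt_phi_transition {p p' : Proj M} (q : piSet p) (hq' : q.1 ∈ piSet p') :
    ∃ h : corner p.compl p → corner p'.compl p', AnalyticAt ℂ h (phi p q) ∧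
      ∀ᶠ y in 𝓝 (phi p q), ∀ (q₁ : Proj M) (hq₁ : q₁ ∈ piSet p), phi p ⟨q₁, hq₁⟩ = y →
        ∃ hq₂ : q₁ ∈ piSet p', phi p' ⟨q₁, hq₂⟩ = h y := by
  have h0 : IsMP (transitionFun p' p (phi p q)) _ p' p := transition_isMP q.2 hq'
  set w₀ : M := (p : M) * ((p' : M) + phi p' ⟨q, hq'⟩)
  let h : corner p.compl p → corner p'.compl p' := fun y =>
    cornerProj p'.compl p' (((p : M) + y) * localInv p w₀ (transitionFun p' p y) - p')
  have hval : AnalyticAt ℂ (fun y : corner p.compl p => (y : M)) (phi p q) :=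
    (corner p.compl p).subtypeL.analyticAt _
  have hh : AnalyticAt ℂ h (phi p q) :=
    ((cornerProj p'.compl p').analyticAt _).fun_comp
      (((analyticAt_const.add hval).mul
        (h0.analyticAt_localInv.fun_comp (analyticAt_transitionFun p' p _))).sub analyticAt_const)
  refine ⟨h, hh, (eventually_isMP_transitionFun h0).mono ?_⟩
  rintro _ hy q' hq1 rfl
  obtain ⟨hq2, he⟩ := phi_transition hq1 hy
  exact ⟨hq2, (cornerProj_eq (sub_eq_of_eq_add' he.symm)).symm⟩

theorem exists_isLocalRepAt_projAtlas {p p' : Proj M} (q : piSet p) (hq' : q.1 ∈ piSet p') :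
    ∃ h, IsLocalRepAt (projAtlas M p) (projAtlas M p') id q h :=
  let ⟨_, hh, H⟩ := exists_analyticAt_phi_transition q hq'
  ⟨_, IsLocalRepAt.of_eventually (isChart_projAtlas p) hh (H.mono fun _ he q' => he q'.1 q'.2)⟩

theorem isAnalyticAtlas_projAtlas : IsAnalyticAtlas (projAtlas M) where
  isChart := isChart_projAtlas
  cover p := ⟨p, p.mem_piSet_self⟩
  compatible p p' :=
    ⟨analyticInCharts_of_forall (isChart_projAtlas p) fun q hq =>
      exists_isLocalRepAt_projAtlas q hq,
    analyticInCharts_of_forall (isChart_projAtlas p') fun q hq =>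
      exists_isLocalRepAt_projAtlas q hq⟩

/-! ### The charts of the groupoid -/

/-- The arrow `σ_{p'}(q') z σ_p(q)⁻¹` from `q` to `q'`, for `z` invertible from `p` to `p'`. -/
noncomputable def arrowOf {p' p q' q : Proj M} (hq' : q' ∈ piSet p') (hq : q ∈ piSet p) {z w : M}
    (hz : IsMP z w p' p) : PInv M :=
  ⟨((p' : M) + phi p' ⟨q', hq'⟩) * z * ((p : M) * (q : M)),
    (((phi_isMP p' ⟨q', hq'⟩).mul hz).mul (phi_isMP p ⟨q, hq⟩).symm).isPartiallyInvertible⟩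

theorem arrowOf_isMP {p' p q' q : Proj M} (hq' : q' ∈ piSet p') (hq : q ∈ piSet p) {z w : M}
    (hz : IsMP z w p' p) : IsMP (arrowOf hq' hq hz : M)
      (((p : M) + phi p ⟨q, hq⟩) * (w * ((p' : M) * (q' : M)))) q' q :=
  ((phi_isMP p' ⟨q', hq'⟩).mul hz).mul (phi_isMP p ⟨q, hq⟩).symm

theorem IsMP.mem_corner {z w : M} {e f : Proj M} (h : IsMP z w e f) : z ∈ corner e f :=
  BLG.mem_corner.mpr ⟨h.ex, h.xf⟩

/-- The model space `(1 - p') M p' ⊕ p' M p ⊕ (1 - p) M p` of the chart `ψ_{p'p}`. -/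
abbrev PsiModel (p' p : Proj M) : Type u :=
  corner p'.compl p' × corner p' p × corner p.compl p

theorem analyticAt_psiModel_mid {p' p : Proj M} (e : PsiModel p' p) :
    AnalyticAt ℂ (fun e : PsiModel p' p => (e.2.1 : M)) e :=
  ((corner p' p).subtypeL.comp ((ContinuousLinearMap.fst ℂ _ _).comp
    (ContinuousLinearMap.snd ℂ (corner p'.compl p') _))).analyticAt e

theorem analyticAt_psiModel_right {p' p : Proj M} (e : PsiModel p' p) :
    AnalyticAt ℂ (fun e : PsiModel p' p => e.2.2) e :=
  ((ContinuousLinearMap.snd ℂ (corner p' p) (corner p.compl p)).comp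
    (ContinuousLinearMap.snd ℂ (corner p'.compl p') _)).analyticAt e

theorem psi_mid (p' p : Proj M) (x : omegaSet p' p) : ((psi p' p x).2.1 : M) =
    (p' : M) * (tgt x.1 : M) * (x.1 : M) * ((p : M) + phi p ⟨src x.1, x.2.2⟩) := by
  change invVal (sigmaArrow p' ⟨tgt x.1, x.2.1⟩) * (x.1 : M) * (sigma p ⟨src x.1, x.2.2⟩ : M) = _
  rw [(isMP (sigmaArrow p' ⟨tgt x.1, x.2.1⟩)).unique (sigma_isMP p' ⟨tgt x.1, x.2.1⟩), sigma_eq]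

/-- The middle coordinate is a product of three arrows `p → S(x) → T(x) → p'`, hence invertible from
`p` to `p'`. -/
theorem psi_mid_isMP (p' p : Proj M) (x : omegaSet p' p) : IsMP ((psi p' p x).2.1 : M)
    ((p : M) * (src x.1 : M) * (invVal x.1 * ((p' : M) + phi p' ⟨tgt x.1, x.2.1⟩))) p' p := by
  rw [psi_mid]
  exact ((phi_isMP p' ⟨tgt x.1, x.2.1⟩).symm.mul (isMP x.1)).mul (phi_isMP p ⟨src x.1, x.2.2⟩)

/-- Every arrow is recovered from its coordinates. -/
theorem arrowOf_psi {p' p : Proj M} (x : omegaSet p' p) :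
    arrowOf x.2.1 x.2.2 (psi_mid_isMP p' p x) = x.1 := by
  apply PInv.ext
  have h1 := phi_isMP p' ⟨tgt x.1, x.2.1⟩
  have h2 := phi_isMP p ⟨src x.1, x.2.2⟩
  have h := isMP x.1
  change ((p' : M) + phi p' ⟨tgt x.1, x.2.1⟩) * ((psi p' p x).2.1 : M) * ((p : M) * (src x.1 : M))
    = x.1
  rw [psi_mid]
  have e : ∀ a b c d t s : M, a * (b * t * x.1 * c) * (d * s) = a * (b * t) * x.1 * (c * (d * s)) :=
    fun a b c d t s => by simp only [mul_assoc]
  exact (e _ _ _ _ _ _).trans (by rw [h1.xw, h.ex, h2.xw, h.xf])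

/-- The value of the chart `ψ_{p'p}` at the arrow `σ_{p'}(q') z σ_p(q)⁻¹`. -/
theorem psi_eq {p' p q' q : Proj M} (hq' : q' ∈ piSet p') (hq : q ∈ piSet p) {z w : M}
    (hz : IsMP z w p' p) {x : PInv M} (hx : (x : M) = arrowOf hq' hq hz) :
    ∃ hx : x ∈ omegaSet p' p,
      psi p' p ⟨x, hx⟩ = (phi p' ⟨q', hq'⟩, ⟨z, hz.mem_corner⟩, phi p ⟨q, hq⟩) := by
  have hm := arrowOf_isMP hq' hq hz
  rw [← hx] at hm
  obtain rfl : tgt x = q' := hm.tgt_eq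
  obtain rfl : src x = q := hm.src_eq
  have hmem : x ∈ omegaSet p' p := ⟨hq', hq⟩
  have h1 := phi_isMP p' ⟨tgt x, hq'⟩
  have h2 := phi_isMP p ⟨src x, hq⟩
  have hmid : (psi p' p ⟨x, hmem⟩).2.1 = ⟨z, hz.mem_corner⟩ := by
    apply Subtype.ext
    rw [psi_mid]
    simp only [hx]
    have e : ∀ a b c d t s : M, a * t * (b * z * (d * s)) * c = a * t * b * z * (d * s * c) :=
      fun a b c d t s => by simp only [mul_assoc]
    exact (e _ _ _ _ _ _).trans (by rw [h1.wx, hz.ex, h2.wx, hz.xf])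
  exact ⟨hmem, Prod.ext rfl (Prod.ext hmid rfl)⟩

theorem psi_injective (p' p : Proj M) : Function.Injective (psi p' p) := by
  have hdec : ∀ x : omegaSet p' p, (x.1 : M) =
      ((p' : M) + ((psi p' p x).1 : M)) * ((psi p' p x).2.1 : M) * ((p : M) * (src x.1 : M)) :=
    fun x => congrArg PInv.val (arrowOf_psi x).symm
  intro x x' h
  have hphi : phi p ⟨src x.1, x.2.2⟩ = phi p ⟨src x'.1, x'.2.2⟩ :=
    congrArg (fun e => Prod.snd (Prod.snd e)) h
  have hsrc : src x.1 = src x'.1 := congrArg Subtype.val (phi_injective p hphi)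
  refine Subtype.ext (PInv.ext ?_)
  rw [hdec x, hdec x', h, hsrc]

/-- The range of `ψ_{p'p}` consists of the triples whose middle coordinate is invertible from `p`
to `p'`. -/
theorem range_psi (p' p : Proj M) :
    Set.range (psi p' p) = {e | ∃ w, IsMP (e.2.1 : M) w p' p} := by
  ext e
  constructor
  · rintro ⟨x, rfl⟩
    exact ⟨_, psi_mid_isMP p' p x⟩
  · rintro ⟨w, hw⟩
    obtain ⟨⟨q', hq'⟩, h1⟩ := (phi_bijective p').2 e.1
    obtain ⟨⟨q, hq⟩, h2⟩ := (phi_bijective p).2 e.2.2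
    obtain ⟨hx, he⟩ := psi_eq hq' hq hw rfl
    exact ⟨⟨_, hx⟩, he.trans (by rw [h1, h2])⟩

/-- The set of `z ∈ p' M p` invertible from `p` to `p'` is open, with analytic inversion. -/
theorem IsMP.eventually_mid {p' p : Proj M}
    {e₀ : PsiModel p' p} {w₀ : M}
    (h : IsMP (e₀.2.1 : M) w₀ p' p) :
    ∀ᶠ e in 𝓝 e₀, IsMP (e.2.1 : M) (localInv p w₀ e.2.1) p' p := by
  filter_upwards [(analyticAt_psiModel_mid e₀).continuousAt.eventually
    h.eventually_isMP_localInv] with e he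
  obtain ⟨h1, h2⟩ := BLG.mem_corner.mp e.2.1.2
  exact he h1 h2

theorem isChart_pinvAtlas (i : {pp : Proj M × Proj M // ProjEquiv pp.2 pp.1}) :
    (pinvAtlas M i).IsChart := by
  refine ⟨psi_injective i.1.1 i.1.2, ?_⟩
  change IsOpen (Set.range (psi i.1.1 i.1.2))
  rw [range_psi, isOpen_iff_mem_nhds]
  rintro e ⟨w, hw⟩
  exact hw.eventually_mid.mono fun e he => ⟨_, he⟩

/-- The middle coordinate of `x` in another chart is `g' z g⁻¹`. -/
theorem psi_mid_transition {p' p r' r : Proj M} {x : PInv M} (hx : x ∈ omegaSet p' p)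
    (hx' : x ∈ omegaSet r' r) : ((psi r' r ⟨x, hx'⟩).2.1 : M) =
      transitionFun r' p' (phi p' ⟨tgt x, hx.1⟩) * ((psi p' p ⟨x, hx⟩).2.1 : M) *
        ((p : M) * ((r : M) + phi r ⟨src x, hx'.2⟩)) := by
  have h1 := phi_isMP p' ⟨tgt x, hx.1⟩
  have h2 := phi_isMP p ⟨src x, hx.2⟩
  have h3 := phi_isMP r ⟨src x, hx'.2⟩
  rw [psi_mid, psi_mid, transitionFun]
  symm
  calc (r' : M) * ((p' : M) + phi p' ⟨tgt x, hx.1⟩) *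
        ((p' : M) * (tgt x : M) * (x : M) * ((p : M) + phi p ⟨src x, hx.2⟩)) *
        ((p : M) * ((r : M) + phi r ⟨src x, hx'.2⟩))
      = (r' : M) * (((p' : M) + phi p' ⟨tgt x, hx.1⟩) * ((p' : M) * (tgt x : M))) * (x : M) *
        (((p : M) + phi p ⟨src x, hx.2⟩) * ((p : M) * (src x : M))) *
          ((r : M) + phi r ⟨src x, hx'.2⟩) := by
        conv_lhs => rw [← h3.ex]
        simp only [mul_assoc]
    _ = (r' : M) * (tgt x : M) * (x : M) * ((r : M) + phi r ⟨src x, hx'.2⟩) := by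
        rw [h1.xw, h2.xw, mul_assoc _ (src x : M), h3.ex]

theorem isLocalRepAt_psi {Y : Type u} {p' p : Proj M} (hp : ProjEquiv p p') {d : BanachChart Y}
    {f : PInv M → Y} {x : PInv M} (hx : x ∈ omegaSet p' p) {h : PsiModel p' p → d.E}
    (hh : AnalyticAt ℂ h (psi p' p ⟨x, hx⟩))
    (H : ∀ᶠ e in 𝓝 (psi p' p ⟨x, hx⟩), ∀ (x' : PInv M) (hx' : x' ∈ omegaSet p' p),
      psi p' p ⟨x', hx'⟩ = e → ∃ hf : f x' ∈ d.dom, d.toFun ⟨f x', hf⟩ = h e) :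
    IsLocalRepAt (pinvAtlas M ⟨(p', p), hp⟩) d f ⟨x, hx⟩ h :=
  IsLocalRepAt.of_eventually (isChart_pinvAtlas _) hh (H.mono fun _ he x' => he x'.1 x'.2)

/-- The middle component `g' z g⁻¹` of the transition map between `ψ_{p'p}` and `ψ_{r'r}`. -/
noncomputable def midTransition (p' p r' r : Proj M) (w₀ : M) (e : PsiModel p' p) : M :=
  transitionFun r' p' e.1 * (e.2.1 : M) * localInv p w₀ (transitionFun r p e.2.2)

theorem analyticAt_midTransition {p' p r' r : Proj M} {w₀ : M} {e : PsiModel p' p}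
    (h : IsMP (transitionFun r p e.2.2) w₀ r p) :
    AnalyticAt ℂ (midTransition p' p r' r w₀) e := by
  have a1 : AnalyticAt ℂ (fun e : PsiModel p' p => transitionFun r' p' e.1) e :=
    (analyticAt_transitionFun r' p' _).fun_comp analyticAt_fst
  have a2 : AnalyticAt ℂ (fun e : PsiModel p' p => (e.2.1 : M)) e :=
    analyticAt_psiModel_mid e
  have a3 : AnalyticAt ℂ (transitionFun r p ∘ fun e : PsiModel p' p => e.2.2) e :=
    (analyticAt_transitionFun r p _).comp (analyticAt_psiModel_right e)
  have a4 : AnalyticAt ℂ (localInv p w₀ ∘ (transitionFun r p ∘ fun e : PsiModel p' p => e.2.2)) e :=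
    AnalyticAt.comp h.analyticAt_localInv a3
  exact (a1.mul a2).mul a4

/-- The transition map between `ψ_{p'p}` and `ψ_{r'r}`: the outer coordinates change by the
transition maps of the set of projections, the middle one by `z ↦ g' z g⁻¹`. -/
theorem exists_analyticAt_psi_transition {p' p r' r : Proj M} {x : PInv M}
    (hx : x ∈ omegaSet p' p) (hx' : x ∈ omegaSet r' r) :
    ∃ h : PsiModel p' p → PsiModel r' r, AnalyticAt ℂ h (psi p' p ⟨x, hx⟩) ∧
      ∀ᶠ e in 𝓝 (psi p' p ⟨x, hx⟩), ∀ (x₁ : PInv M) (hx₁ : x₁ ∈ omegaSet p' p),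
        psi p' p ⟨x₁, hx₁⟩ = e → ∃ hx₂ : x₁ ∈ omegaSet r' r, psi r' r ⟨x₁, hx₂⟩ = h e := by
  obtain ⟨k', hk', H'⟩ := exists_analyticAt_phi_transition ⟨tgt x, hx.1⟩ hx'.1
  obtain ⟨k, hk, H⟩ := exists_analyticAt_phi_transition ⟨src x, hx.2⟩ hx'.2
  have h0 : IsMP (transitionFun r p (phi p ⟨src x, hx.2⟩)) _ r p := transition_isMP hx.2 hx'.2
  have H₀ := eventually_isMP_transitionFun h0
  have hu : ∀ (x₁ : PInv M) (hx₁ : x₁ ∈ omegaSet p' p) (hx₂ : x₁ ∈ omegaSet r' r) (w : M),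
      IsMP (transitionFun r p (phi p ⟨src x₁, hx₁.2⟩)) w r p →
        w = (p : M) * ((r : M) + phi r ⟨src x₁, hx₂.2⟩) :=
    fun x₁ hx₁ hx₂ w hw => hw.unique (transition_isMP hx₁.2 hx₂.2)
  generalize (p : M) * ((r : M) + phi r ⟨src x, hx'.2⟩) = w₀ at h0 H₀
  have e1 : (psi p' p ⟨x, hx⟩).1 = phi p' ⟨tgt x, hx.1⟩ := rfl
  have e2 : (psi p' p ⟨x, hx⟩).2.2 = phi p ⟨src x, hx.2⟩ := rfl
  rw [← e1] at hk' H'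
  rw [← e2] at hk H h0 H₀
  generalize psi p' p ⟨x, hx⟩ = e₀ at hk' H' hk H h0 H₀
  refine ⟨fun e => (k' e.1, cornerProj r' r (midTransition p' p r' r w₀ e), k e.2.2), ?_, ?_⟩
  · have c1 : AnalyticAt ℂ (fun e : PsiModel p' p => k' e.1) e₀ := hk'.fun_comp analyticAt_fst
    have c2 : AnalyticAt ℂ (fun e : PsiModel p' p => cornerProj r' r
        (midTransition p' p r' r w₀ e)) e₀ :=
      ((cornerProj r' r).analyticAt _).fun_comp (analyticAt_midTransition h0)
    have c3 : AnalyticAt ℂ (k ∘ fun e : PsiModel p' p => e.2.2) e₀ :=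
      AnalyticAt.comp (g := k) hk (analyticAt_psiModel_right _)
    exact c1.prod (c2.prod c3)
  · have c1 : Tendsto (fun e : PsiModel p' p => e.1) (𝓝 e₀) (𝓝 e₀.1) := continuousAt_fst
    have c3 : Tendsto (fun e : PsiModel p' p => e.2.2) (𝓝 e₀) (𝓝 e₀.2.2) :=
      (analyticAt_psiModel_right e₀).continuousAt
    filter_upwards [c1.eventually H', c3.eventually H, c3.eventually H₀] with e hH' hH hH₀ x₁ hx₁ he
    subst he
    obtain ⟨hq', hq1'⟩ := hH' (tgt x₁) hx₁.1 rfl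
    obtain ⟨hq, hq1⟩ := hH (src x₁) hx₁.2 rfl
    have hx₂ : x₁ ∈ omegaSet r' r := ⟨hq', hq⟩
    have hmid : cornerProj r' r (midTransition p' p r' r w₀ (psi p' p ⟨x₁, hx₁⟩)) =
        (psi r' r ⟨x₁, hx₂⟩).2.1 := by
      apply cornerProj_eq
      rw [psi_mid_transition hx₁ hx₂, ← hu x₁ hx₁ hx₂ _ hH₀]
      rfl
    exact ⟨hx₂, Prod.ext hq1' (Prod.ext hmid.symm hq1)⟩

theorem exists_isLocalRepAt_pinvAtlas (i j : {pp : Proj M × Proj M // ProjEquiv pp.2 pp.1})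
    (x : (pinvAtlas M i).dom) (hx' : x.1 ∈ (pinvAtlas M j).dom) :
    ∃ h, IsLocalRepAt (pinvAtlas M i) (pinvAtlas M j) id x h := by
  obtain ⟨⟨p', p⟩, hp⟩ := i
  obtain ⟨⟨r', r⟩, hr⟩ := j
  obtain ⟨x, hx⟩ := x
  change x ∈ omegaSet p' p at hx
  change x ∈ omegaSet r' r at hx'
  obtain ⟨h, hh, H⟩ := exists_analyticAt_psi_transition hx hx'
  exact ⟨h, isLocalRepAt_psi hp hx hh H⟩

theorem isAnalyticAtlas_pinvAtlas : IsAnalyticAtlas (pinvAtlas M) where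
  isChart := isChart_pinvAtlas
  cover x := ⟨⟨(tgt x, src x), x, rfl, rfl⟩, (tgt x).mem_piSet_self, (src x).mem_piSet_self⟩
  compatible i j :=
    ⟨analyticInCharts_of_forall (isChart_pinvAtlas i) fun x hx =>
      exists_isLocalRepAt_pinvAtlas i j x hx,
    analyticInCharts_of_forall (isChart_pinvAtlas j) fun x hx =>
      exists_isLocalRepAt_pinvAtlas j i x hx⟩

/-! ### The structure maps in the charts -/

theorem isLocalRepAt_src {p' p : Proj M} (hp : ProjEquiv p p') {x : PInv M}
    (hx : x ∈ omegaSet p' p) :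
    IsLocalRepAt (pinvAtlas M ⟨(p', p), hp⟩) (projAtlas M p) src ⟨x, hx⟩
      (fun e : PsiModel p' p => e.2.2) := by
  refine isLocalRepAt_psi hp hx (analyticAt_psiModel_right _) (Eventually.of_forall ?_)
  rintro _ x₁ hx₁ rfl
  exact ⟨hx₁.2, rfl⟩

theorem isLocalRepAt_tgt {p' p : Proj M} (hp : ProjEquiv p p') {x : PInv M}
    (hx : x ∈ omegaSet p' p) :
    IsLocalRepAt (pinvAtlas M ⟨(p', p), hp⟩) (projAtlas M p') tgt ⟨x, hx⟩
      (fun e : PsiModel p' p => e.1) := by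
  refine isLocalRepAt_psi hp hx analyticAt_fst (Eventually.of_forall ?_)
  rintro _ x₁ hx₁ rfl
  exact ⟨hx₁.1, rfl⟩

theorem isAnalyticMap_src : IsAnalyticMap (pinvAtlas M) (projAtlas M) src :=
  isAnalyticMap_of_local isAnalyticAtlas_pinvAtlas isAnalyticAtlas_projAtlas fun x =>
    ⟨⟨(tgt x, src x), x, rfl, rfl⟩, ⟨(tgt x).mem_piSet_self, (src x).mem_piSet_self⟩, src x, _,
      isLocalRepAt_src _ _⟩

theorem isAnalyticMap_tgt : IsAnalyticMap (pinvAtlas M) (projAtlas M) tgt :=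
  isAnalyticMap_of_local isAnalyticAtlas_pinvAtlas isAnalyticAtlas_projAtlas fun x =>
    ⟨⟨(tgt x, src x), x, rfl, rfl⟩, ⟨(tgt x).mem_piSet_self, (src x).mem_piSet_self⟩, tgt x, _,
      isLocalRepAt_tgt _ _⟩

theorem phi_self (p : Proj M) : phi p ⟨p, p.mem_piSet_self⟩ = 0 :=
  (IsMP.phi_eq (y := (0 : corner p.compl p)) (w := (p : M)) (q := p) (by simpa using p.isMP)).2

theorem arrowOf_self (x : PInv M) :
    arrowOf (tgt x).mem_piSet_self (src x).mem_piSet_self (isMP x) = x := by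
  apply PInv.ext
  change ((tgt x : M) + phi (tgt x) ⟨tgt x, _⟩) * (x : M) * ((src x : M) * (src x : M)) = x
  rw [phi_self, Proj.mul_self]
  simp [(isMP x).ex, (isMP x).xf]

open Classical in
/-- A section of the source map through `x`: `q ↦ x σ_p(q)⁻¹` with `p = S(x)`. Outside `Π_p` it is
extended by the identity section. -/
noncomputable def srcSection (x : PInv M) (q : Proj M) : PInv M :=
  if hq : q ∈ piSet (src x) then arrowOf (tgt x).mem_piSet_self hq (isMP x) else punit q

theorem src_srcSection (x : PInv M) (q : Proj M) : src (srcSection x q) = q := by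
  unfold srcSection
  split_ifs with hq
  · exact (arrowOf_isMP _ _ _).src_eq
  · exact IsMP.src_eq (x := punit q) q.isMP

theorem srcSection_src (x : PInv M) : srcSection x (src x) = x := by
  rw [srcSection, dif_pos (src x).mem_piSet_self, arrowOf_self]

theorem isLocalRepAt_srcSection (x : PInv M) :
    IsLocalRepAt (projAtlas M (src x)) (pinvAtlas M ⟨(tgt x, src x), x, rfl, rfl⟩) (srcSection x)
      ⟨src x, (src x).mem_piSet_self⟩ (fun y : corner (src x).compl (src x) =>
        ((0, ⟨x, (isMP x).mem_corner⟩, y) : PsiModel (tgt x) (src x))) := by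
  have hh : AnalyticAt ℂ (fun y : corner (src x).compl (src x) =>
      ((0, ⟨x, (isMP x).mem_corner⟩, y) : PsiModel (tgt x) (src x)))
      (phi (src x) ⟨src x, (src x).mem_piSet_self⟩) :=
    analyticAt_const.prod (analyticAt_const.prod analyticAt_id)
  refine IsLocalRepAt.of_eventually (isChart_projAtlas _) hh (Eventually.of_forall ?_)
  rintro _ ⟨q, hq⟩ rfl
  change q ∈ piSet (src x) at hq
  obtain ⟨h1, h2⟩ := psi_eq (tgt x).mem_piSet_self hq (isMP x) (x := srcSection x q)
    (by rw [srcSection, dif_pos hq])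
  exact ⟨h1, h2.trans (by rw [phi_self]; rfl)⟩

open Classical in
/-- A section of the target map through `x`: `q ↦ σ_p(q) x` with `p = T(x)`. Outside `Π_p` it is
extended by the identity section. -/
noncomputable def tgtSection (x : PInv M) (q : Proj M) : PInv M :=
  if hq : q ∈ piSet (tgt x) then arrowOf hq (src x).mem_piSet_self (isMP x) else punit q

theorem tgt_tgtSection (x : PInv M) (q : Proj M) : tgt (tgtSection x q) = q := by
  unfold tgtSection
  split_ifs with hq
  · exact (arrowOf_isMP _ _ _).tgt_eq
  · exact IsMP.tgt_eq (x := punit q) q.isMP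

theorem tgtSection_tgt (x : PInv M) : tgtSection x (tgt x) = x := by
  rw [tgtSection, dif_pos (tgt x).mem_piSet_self, arrowOf_self]

theorem isLocalRepAt_tgtSection (x : PInv M) :
    IsLocalRepAt (projAtlas M (tgt x)) (pinvAtlas M ⟨(tgt x, src x), x, rfl, rfl⟩) (tgtSection x)
      ⟨tgt x, (tgt x).mem_piSet_self⟩ (fun y : corner (tgt x).compl (tgt x) =>
        ((y, ⟨x, (isMP x).mem_corner⟩, 0) : PsiModel (tgt x) (src x))) := by
  have hh : AnalyticAt ℂ (fun y : corner (tgt x).compl (tgt x) =>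
      ((y, ⟨x, (isMP x).mem_corner⟩, 0) : PsiModel (tgt x) (src x)))
      (phi (tgt x) ⟨tgt x, (tgt x).mem_piSet_self⟩) :=
    analyticAt_id.prod analyticAt_const
  refine IsLocalRepAt.of_eventually (isChart_projAtlas _) hh (Eventually.of_forall ?_)
  rintro _ ⟨q, hq⟩ rfl
  change q ∈ piSet (tgt x) at hq
  obtain ⟨h1, h2⟩ := psi_eq hq (src x).mem_piSet_self (isMP x) (x := tgtSection x q)
    (by rw [tgtSection, dif_pos hq])
  exact ⟨h1, h2.trans (by rw [phi_self]; rfl)⟩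

theorem isAnalyticSubmersion_src : IsAnalyticSubmersion (pinvAtlas M) (projAtlas M) src :=
  isAnalyticSubmersion_of_section isAnalyticAtlas_pinvAtlas isAnalyticAtlas_projAtlas
    isAnalyticMap_src fun x => ⟨srcSection x, src x, (src x).mem_piSet_self, _, _,
      src_srcSection x, srcSection_src x, isLocalRepAt_srcSection x⟩

theorem isAnalyticSubmersion_tgt : IsAnalyticSubmersion (pinvAtlas M) (projAtlas M) tgt :=
  isAnalyticSubmersion_of_section isAnalyticAtlas_pinvAtlas isAnalyticAtlas_projAtlas
    isAnalyticMap_tgt fun x => ⟨tgtSection x, tgt x, (tgt x).mem_piSet_self, _, _,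
      tgt_tgtSection x, tgtSection_tgt x, isLocalRepAt_tgtSection x⟩

theorem projEquiv_self (p : Proj M) : ProjEquiv p p :=
  ⟨punit p, IsMP.src_eq (x := punit p) p.isMP, IsMP.tgt_eq (x := punit p) p.isMP⟩

/-- In the charts the identity section is `y ↦ (y, p, y)`. -/
theorem isLocalRepAt_punit (p : Proj M) :
    IsLocalRepAt (projAtlas M p) (pinvAtlas M ⟨(p, p), projEquiv_self p⟩) punit
      ⟨p, p.mem_piSet_self⟩ (fun y : corner p.compl p =>
        ((y, ⟨p, p.isMP.mem_corner⟩, y) : PsiModel p p)) := by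
  have hh : AnalyticAt ℂ (fun y : corner p.compl p =>
      ((y, ⟨p, p.isMP.mem_corner⟩, y) : PsiModel p p)) (phi p ⟨p, p.mem_piSet_self⟩) :=
    analyticAt_id.prod (analyticAt_const.prod analyticAt_id)
  refine IsLocalRepAt.of_eventually (isChart_projAtlas _) hh (Eventually.of_forall ?_)
  rintro _ ⟨q, hq⟩ rfl
  exact psi_eq hq hq p.isMP (x := punit q) (by
    change (q : M) = ((p : M) + phi p ⟨q, hq⟩) * (p : M) * ((p : M) * (q : M))
    rw [Proj.add_corner_compl_mul, (phi_isMP p ⟨q, hq⟩).xw])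

theorem isAnalyticMap_punit : IsAnalyticMap (projAtlas M) (pinvAtlas M) punit :=
  isAnalyticMap_of_local isAnalyticAtlas_projAtlas isAnalyticAtlas_pinvAtlas fun p =>
    ⟨p, p.mem_piSet_self, _, _, isLocalRepAt_punit p⟩

theorem isAnalyticEmbedding_punit : IsAnalyticEmbedding (projAtlas M) (pinvAtlas M) punit :=
  isAnalyticEmbedding_of_leftInverse isAnalyticAtlas_projAtlas isAnalyticAtlas_pinvAtlas
    isAnalyticMap_punit isAnalyticMap_src (pinvGroupoid M).source_unit

/-- In the charts inversion is `(y', z, y) ↦ (y, z⁻¹, y')`. -/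
theorem psi_pinv {p' p : Proj M} {x : PInv M} (hx : x ∈ omegaSet p' p) {w : M}
    (hw : IsMP ((psi p' p ⟨x, hx⟩).2.1 : M) w p' p) :
    ∃ hx' : pinv x ∈ omegaSet p p', psi p p' ⟨pinv x, hx'⟩ =
      ((psi p' p ⟨x, hx⟩).2.2, ⟨w, hw.symm.mem_corner⟩, (psi p' p ⟨x, hx⟩).1) := by
  refine psi_eq hx.2 hx.1 hw.symm (x := pinv x) ?_
  have h1 := arrowOf_isMP hx.1 hx.2 hw
  have h2 : arrowOf hx.1 hx.2 hw = x := arrowOf_psi ⟨x, hx⟩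
  rw [h2] at h1
  exact ((isMP x).unique h1).trans (mul_assoc _ _ _).symm

theorem exists_isLocalRepAt_pinv {p' p : Proj M} (h : ProjEquiv p p') (h' : ProjEquiv p' p)
    {x : PInv M} (hx : x ∈ omegaSet p' p) :
    ∃ k, IsLocalRepAt (pinvAtlas M ⟨(p', p), h⟩) (pinvAtlas M ⟨(p, p'), h'⟩) pinv ⟨x, hx⟩ k := by
  have h0 := psi_mid_isMP p' p ⟨x, hx⟩
  generalize (p : M) * (src x : M) * (invVal x * ((p' : M) + phi p' ⟨tgt x, hx.1⟩)) = w₀ at h0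
  have H := h0.eventually_mid
  have hh : AnalyticAt ℂ (fun e : PsiModel p' p =>
      ((e.2.2, cornerProj p p' (localInv p w₀ e.2.1), e.1) : PsiModel p p'))
      (psi p' p ⟨x, hx⟩) := by
    have c2 : AnalyticAt ℂ (localInv p w₀ ∘ fun e : PsiModel p' p => (e.2.1 : M))
        (psi p' p ⟨x, hx⟩) :=
      AnalyticAt.comp (g := localInv p w₀) h0.analyticAt_localInv (analyticAt_psiModel_mid _)
    exact (analyticAt_psiModel_right _).prod
      ((((cornerProj p p').analyticAt _).comp c2).prod analyticAt_fst)
  refine ⟨_, isLocalRepAt_psi _ hx hh (H.mono ?_)⟩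
  rintro _ hw x₁ hx₁ rfl
  obtain ⟨h1, h2⟩ := psi_pinv hx₁ hw
  exact ⟨h1, h2.trans (Prod.ext rfl (Prod.ext (cornerProj_eq rfl).symm rfl))⟩

theorem isAnalyticMap_pinv : IsAnalyticMap (pinvAtlas M) (pinvAtlas M) pinv :=
  isAnalyticMap_of_local isAnalyticAtlas_pinvAtlas isAnalyticAtlas_pinvAtlas fun x =>
    
    have h : ProjEquiv (tgt x) (src x) :=
      ⟨pinv x, (pinvGroupoid M).source_inv x, (pinvGroupoid M).target_inv x⟩
    ⟨⟨(tgt x, src x), x, rfl, rfl⟩, ⟨(tgt x).mem_piSet_self, (src x).mem_piSet_self⟩,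
      ⟨(src x, tgt x), h⟩, exists_isLocalRepAt_pinv _ h _⟩

/-- In the charts the product is `((y'', z, y'), (y', w, y)) ↦ (y'', z w, y)`. -/
theorem psi_pmul {p'' p' p : Proj M} {x y : PInv M} (hx : x ∈ omegaSet p'' p')
    (hy : y ∈ omegaSet p' p) (h : src x = tgt y) :
    ∃ hxy : pmul x y h ∈ omegaSet p'' p, psi p'' p ⟨pmul x y h, hxy⟩ =
      ((psi p'' p' ⟨x, hx⟩).1, cornerProj p'' p
        (((psi p'' p' ⟨x, hx⟩).2.1 : M) * ((psi p' p ⟨y, hy⟩).2.1 : M)),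
          (psi p' p ⟨y, hy⟩).2.2) := by
  have h1 := psi_mid_isMP p'' p' ⟨x, hx⟩
  have h2 := psi_mid_isMP p' p ⟨y, hy⟩
  obtain ⟨hxy, he⟩ := psi_eq hx.1 hy.2 (h1.mul h2) (x := pmul x y h) (by
    have e1 : (x : M) = ((p'' : M) + phi p'' ⟨tgt x, hx.1⟩) * ((psi p'' p' ⟨x, hx⟩).2.1 : M) *
      ((p' : M) * (src x : M)) := congrArg PInv.val (arrowOf_psi ⟨x, hx⟩).symm
    have e2 : (y : M) = ((p' : M) + phi p' ⟨tgt y, hy.1⟩) * ((psi p' p ⟨y, hy⟩).2.1 : M) *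
      ((p : M) * (src y : M)) := congrArg PInv.val (arrowOf_psi ⟨y, hy⟩).symm
    have e3 := (phi_isMP p' ⟨tgt y, hy.1⟩).wx
    have e4 := h1.xf
    change (x : M) * (y : M) = ((p'' : M) + phi p'' ⟨tgt x, hx.1⟩) *
      (((psi p'' p' ⟨x, hx⟩).2.1 : M) * ((psi p' p ⟨y, hy⟩).2.1 : M)) * ((p : M) * (src y : M))
    have hst : (src x : M) = (tgt y : M) := by rw [h]
    rw [hst] at e1
    generalize ((psi p'' p' ⟨x, hx⟩).2.1 : M) = z at e1 e4 ⊢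
    generalize ((psi p' p ⟨y, hy⟩).2.1 : M) = w at e2 ⊢
    rw [e1, e2]
    have e : ∀ a b c d s t : M, a * z * (b * c) * (d * w * (s * t)) =
      a * (z * (b * c * d)) * w * (s * t) := fun a b c d s t => by simp only [mul_assoc]
    refine (e _ _ _ _ _ _).trans ?_
    rw [e3, e4]
    simp only [mul_assoc])
  exact ⟨hxy, he.trans (Prod.ext rfl (Prod.ext (cornerProj_eq rfl).symm rfl))⟩

/-- The difference of the coordinates of source and target: its kernel consists of the composable
pairs. -/
noncomputable def gapMap (p'' p' p : Proj M) :
    PsiModel p'' p' × PsiModel p' p →L[ℂ] corner p'.compl p' :=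
  ((ContinuousLinearMap.snd ℂ _ _).comp (ContinuousLinearMap.snd ℂ _ _)).comp
      (ContinuousLinearMap.fst ℂ _ _) -
    (ContinuousLinearMap.fst ℂ _ _).comp (ContinuousLinearMap.snd ℂ _ _)

/-- On the product of the charts `ψ_{p''p'}` and `ψ_{p'p}` the pair is composable exactly when the
third coordinate of the first arrow is the first coordinate of the second one. -/
noncomputable def composableChart {p'' p' p : Proj M} (h : ProjEquiv p' p'')
    (h' : ProjEquiv p p') :
    AdaptedChart (prodAtlas (pinvAtlas M) (pinvAtlas M)) (pinvGroupoid M).composable where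
  chart := prodAtlas (pinvAtlas M) (pinvAtlas M) (⟨(p'', p'), h⟩, ⟨(p', p), h'⟩)
  isChart := (isAnalyticAtlas_pinvAtlas.prodAtlas isAnalyticAtlas_pinvAtlas).isChart _
  compatible := (isAnalyticAtlas_pinvAtlas.prodAtlas isAnalyticAtlas_pinvAtlas).compatible _
  F := LinearMap.ker (gapMap p'' p' p).toLinearMap
  complemented := (gapMap p'' p' p).closedComplemented_ker_of_rightInverse
    ((ContinuousLinearMap.inl ℂ _ _).comp
      ((ContinuousLinearMap.inr ℂ _ _).comp (ContinuousLinearMap.inr ℂ _ _)))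
    fun v => by simp [gapMap]
  slice := by
    have key : ∀ (x y : PInv M) (hx : x ∈ omegaSet p'' p') (hy : y ∈ omegaSet p' p),
        src x = tgt y ↔ gapMap p'' p' p (psi p'' p' ⟨x, hx⟩, psi p' p ⟨y, hy⟩) = 0 := by
      intro x y hx hy
      change _ ↔ phi p' ⟨src x, hx.2⟩ - phi p' ⟨tgt y, hy.1⟩ = 0
      rw [sub_eq_zero, (phi_injective p').eq_iff, Subtype.mk.injEq]
    ext e
    constructor
    · rintro ⟨⟨⟨x, y⟩, hx, hy⟩, hxy, rfl⟩
      exact ⟨⟨_, rfl⟩, (key x y hx hy).mp hxy⟩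
    · rintro ⟨⟨⟨⟨x, y⟩, hx, hy⟩, rfl⟩, hxy⟩
      exact ⟨_, (key x y hx hy).mpr hxy, rfl⟩

theorem isSubmanifold_composable :
    IsSubmanifold (prodAtlas (pinvAtlas M) (pinvAtlas M)) (pinvGroupoid M).composable := by
  rintro ⟨x, y⟩ (hxy : src x = tgt y)
  refine ⟨composableChart (p'' := tgt x) (p' := src x) (p := src y) ⟨x, rfl, rfl⟩
    ⟨y, rfl, hxy.symm⟩, ⟨(tgt x).mem_piSet_self, (src x).mem_piSet_self⟩, ?_,
      (src y).mem_piSet_self⟩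
  change tgt y ∈ piSet (src x)
  rw [hxy]
  exact (tgt y).mem_piSet_self

/-- The product in the charts. -/
noncomputable def mulModel (p'' p' p : Proj M) (e : PsiModel p'' p' × PsiModel p' p) :
    PsiModel p'' p :=
  (e.1.1, cornerProj p'' p ((e.1.2.1 : M) * (e.2.2.1 : M)), e.2.2.2)

theorem analyticAt_mulModel (p'' p' p : Proj M) (e : PsiModel p'' p' × PsiModel p' p) :
    AnalyticAt ℂ (mulModel p'' p' p) e := by
  have a1 : AnalyticAt ℂ (fun e : PsiModel p'' p' × PsiModel p' p => e.1.1) e :=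
    analyticAt_fst.fun_comp analyticAt_fst
  have a2 : AnalyticAt ℂ ((fun e : PsiModel p'' p' => (e.2.1 : M)) ∘
      fun e : PsiModel p'' p' × PsiModel p' p => e.1) e :=
    (analyticAt_psiModel_mid e.1).comp analyticAt_fst
  have a3 : AnalyticAt ℂ ((fun e : PsiModel p' p => (e.2.1 : M)) ∘
      fun e : PsiModel p'' p' × PsiModel p' p => e.2) e :=
    (analyticAt_psiModel_mid e.2).comp analyticAt_snd
  have a4 : AnalyticAt ℂ ((fun e : PsiModel p' p => e.2.2) ∘
      fun e : PsiModel p'' p' × PsiModel p' p => e.2) e :=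
    (analyticAt_psiModel_right e.2).comp analyticAt_snd
  exact a1.prod ((((cornerProj p'' p).analyticAt _).fun_comp (a2.mul a3)).prod a4)

theorem isAnalyticMap_mulMap :
    IsAnalyticMap (subAtlas (prodAtlas (pinvAtlas M) (pinvAtlas M)) (pinvGroupoid M).composable)
      (pinvAtlas M) (pinvGroupoid M).mulMap := by
  intro a j
  refine analyticInCharts_of_forall (isChart_subAtlas _ a) ?_
  rintro ⟨⟨⟨x, y⟩, hxy⟩, hs⟩ hm
  have hxy' : src x = tgt y := hxy
  have hp : ProjEquiv (src y) (tgt x) := ⟨pmul x y hxy', (pinvGroupoid M).source_mul x y hxy',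
    (pinvGroupoid M).target_mul x y hxy'⟩
  have hx : x ∈ omegaSet (tgt x) (src x) := ⟨(tgt x).mem_piSet_self, (src x).mem_piSet_self⟩
  have hy : y ∈ omegaSet (src x) (src y) := ⟨hxy' ▸ (tgt y).mem_piSet_self,
    (src y).mem_piSet_self⟩
  obtain ⟨h, hh⟩ := exists_isLocalRepAt_val a
    (⟨(tgt x, src x), x, rfl, rfl⟩, ⟨(src x, src y), y, rfl, hxy'.symm⟩)
    ⟨⟨⟨x, y⟩, hxy⟩, hs⟩ ⟨hx, hy⟩
  -- The product is `mulModel` after the inclusion into the product manifold.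
  have hmul : IsLocalRepAt (subAtlas _ _ a) (pinvAtlas M ⟨(tgt x, src y), hp⟩)
      (pinvGroupoid M).mulMap ⟨⟨⟨x, y⟩, hxy⟩, hs⟩
      (mulModel (tgt x) (src x) (src y) ∘ h) := by
    refine ⟨AnalyticAt.comp (g := mulModel (tgt x) (src x) (src y))
      (analyticAt_mulModel _ _ _ _) hh.1, hh.2.mono ?_⟩
    rintro e ⟨⟨⟨⟨x₁, y₁⟩, hxy₁⟩, hs₁⟩, rfl, ⟨hx₁, hy₁⟩, he⟩
    obtain ⟨h1, h2⟩ := psi_pmul hx₁ hy₁ hxy₁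
    exact ⟨_, rfl, h1, h2.trans (congrArg (mulModel (tgt x) (src x) (src y)) he)⟩
  obtain ⟨hm', -⟩ := hmul.apply_eq (isChart_subAtlas _ a)
  obtain ⟨k, hk⟩ := exists_isLocalRepAt_pinvAtlas _ j ⟨_, hm'⟩ hm
  have hc := hk.comp (isChart_subAtlas _ a) (isChart_pinvAtlas _) rfl hmul
  exact ⟨_, hc⟩

theorem isBanachLieGroupoid_pinvGroupoid :
    IsBanachLieGroupoid (pinvGroupoid M) (pinvAtlas M) (projAtlas M) where
  arrows_atlas := isAnalyticAtlas_pinvAtlas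
  base_atlas := isAnalyticAtlas_projAtlas
  source_submersion := isAnalyticSubmersion_src
  target_submersion := isAnalyticSubmersion_tgt
  unit_embedding := isAnalyticEmbedding_punit
  inv_analytic := isAnalyticMap_pinv
  composable_submanifold := isSubmanifold_composable
  mul_analytic := isAnalyticMap_mulMap

end Algebra

end BLG

theorem mainTheorem1 (M : Type u) [CStarAlgebra M] [WStarAlgebra M] :
    (∀ p : BLG.Proj M, Function.Bijective (BLG.phi p)) ∧
      BLG.IsBanachLieGroupoid (BLG.pinvGroupoid M) (BLG.pinvAtlas M) (BLG.projAtlas M) :=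
  ⟨BLG.phi_bijective, BLG.isBanachLieGroupoid_pinvGroupoid⟩
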